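/- **Theorem (weight hierarchy of $\mathcal C'_{Q,N}$).** Let $p$ be an odd prime, $m,m_1,m_2\ge 1$ integers, $q=p^m$, $M=m_1+m_2$, and let $\mathbb F_{q^{m_1}},\mathbb F_{q^{m_2}}$ be extensions of $\mathbb F_q$ of degrees $m_1,m_2$. Let $Q:\mathbb F_{q^{m_1}}\to\mathbb F_q$ be a nonzero quadratic form over $\mathbb F_q$, with bilinear form $B_Q(x,y)=\frac12\big(Q(x+y)-Q(x)-Q(y)\big)$ and rank $r_Q=m_1-\dim\{x: B_Q(x,y)=0\ \text{for all } y\}$. Let $\Delta_Q$ be the product of the nonzero entries of a diagonal matrix representing $Q$, let $\eta$ be the quadratic character of $\mathbb F_q$, let $\varepsilon_Q=\eta(\Delta_Q)\in\{1,-1\}$ (it does not depend on the diagonalization), and, when $r_Q$ is even, put $\epsilon=\varepsilon_Q(-1)^{(p-1)mr_Q/4}$. Let $\mathcal C_Q'$ be the $\mathbb F_q$-linear code $$\mathcal C'_Q=\big\{\big(aQ(x)+\mathrm{Tr}_{q^{m_2}/q}(by)+c\big)_{(x,y)\in \mathbb F_{q^{m_1}}\times\mathbb F_{q^{m_2}}}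 : a\in\mathbb F_q,\ b\in\mathbb F_{q^{m_2}},\ c\in\mathbb F_q\big\}.$$ Let $N$ be a positive divisor of $p-1$ with $\gcd\big(N,\frac{q-1}{p-1}\big)=1$, let $\theta\in\mathbb F_q$ be a primitive $\frac{q-1}{N}$-th root of unity, and for $\gamma\in\mathbb F_q$ put $\psi_\gamma=\big(\mathrm{Tr}_{q/p}(\gamma\theta^i)\big)_{0\le i<(q-1)/N}$. Let $\mathcal C'_{Q,N}$ be the $\mathbb F_p$-linear code of length $q^M\frac{q-1}{N}$ obtained from $\mathcal C'_Q$ by replacing every coordinate $c_j$ of every codeword by the vector $\psi_{c_j}$. For an $\mathbb F_p$-linear code $\mathcal C$ of dimension $k$ and $1\le r\le k$, let $d_r(\mathcal C)$ be the $r$-th generalized Hamming weight, i.e. the minimum, over all $r$-dimensional $\mathbb F_p$-subspaces $D$ of $\mathcal C$, of the number of positions at which some word of $D$ is nonzero. Then $\dim_{\mathbb F_p}\mathcal C'_{Q,N}=m(m_2+2)$, and for every $1\le r\le m(m_2+2)$: (1) If $r_Q$ is even and $\epsilon=1$, then $$d_r(\mathcal C'_{Q,N})=\begin{cases}\frac{q^M(q-1)}{p^rN}(p^r-1)\big(1-q^{-\frac{r_Q}2}\big),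 & 1\le r\le m,\\ \frac{q^M(q-1)}{p^rN}\big(p^r-1-q^{-\frac{r_Q}2}(q-1)\big), & m<r\le m(m_2+1),\\ \frac{q^M}{p^rN}\Big(p^r(q-1)-\big(q-p^{r-m(m_2+1)}\big)\big(1+q^{-\frac{r_Q}2}(q-1)\big)\Big), & r>m(m_2+1).\end{cases}$$ (2) If $r_Q$ is even and $\epsilon=-1$, then $$d_r(\mathcal C'_{Q,N})=\begin{cases}\frac{q^M}{p^rN}(p^r-1)\big(q-1-q^{-\frac{r_Q}2}\big), & 1\le r\le m,\\ \frac{q^M(q-1)}{p^rN}\big(p^r-1-q^{-\frac{r_Q}2}\big), & m<r\le m(m_2+1),\\ \frac{q^M}{p^rN}\Big(p^r(q-1)-\big(q-p^{r-m(m_2+1)}\big)\big(1+q^{-\frac{r_Q}2}\big)\Big), & r>m(m_2+1).\end{cases}$$ (3) If $r_Q$ is odd, then $$d_r(\mathcal C'_{Q,N})=\begin{cases}\frac{q^M}{p^rN}(p^r-1)\big(q-1-q^{\frac{1-r_Q}2}\big), & 1\le r\le m,\\ \frac{q^M(q-1)}{p^rN}\big(p^r-1-q^{\frac{1-r_Q}2}\big),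 & m<r\le m(m_2+1),\\ \frac{q^M}{p^rN}\Big(p^r(q-1)-\big(q-p^{r-m(m_2+1)}\big)\big(1+q^{\frac{1-r_Q}2}\big)\Big), & r>m(m_2+1).\end{cases}$$ -/

import Mathlib

namespace QuadCode

/-! ### Linear codes and generalized Hamming weights -/

section GHW

variable {F ι : Type*} [Field F]

/-- The support of a subspace `D` of `F^ι`: the positions at which some word of `D` is nonzero. -/
def supp (D : Submodule F (ι → F)) : Set ι :=
  {i | ∃ c ∈ D, c i ≠ 0}

/-- The `r`-th generalized Hamming weight of a linear code `C ⊆ F^ι` (with `ι` finite):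
the least support size of an `r`-dimensional subspace of `C`.
It is meaningful for `1 ≤ r ≤ dim C`. -/
noncomputable def ghw (C : Submodule F (ι → F)) (r : ℕ) : ℕ :=
  sInf {n | ∃ D : Submodule F (ι → F), D ≤ C ∧ Module.finrank F D = r ∧ (supp D).ncard = n}

end GHW

/-! ### Quadratic forms over finite fields of odd characteristic -/

section Forms

variable {K E : Type*} [Field K] [AddCommGroup E] [Module K E]

/-- The bilinear form `B_Q(x, y) = (Q(x + y) - Q(x) - Q(y)) / 2`. -/
noncomputable def bilin (Q : QuadraticForm K E) : LinearMap.BilinForm K E :=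
  (2 : K)⁻¹ • Q.polarBilin

theorem bilin_apply (Q : QuadraticForm K E) (x y : E) :
    bilin Q x y = (2 : K)⁻¹ * (Q (x + y) - Q x - Q y) := rfl

/-- The rank of `Q`: the codimension of `{x | ∀ y, B_Q(x, y) = 0}`. -/
noncomputable def rank (Q : QuadraticForm K E) : ℕ :=
  Module.finrank K E - Module.finrank K (LinearMap.ker (bilin Q))

/-- The product of the nonzero values of `Q` on a family of vectors. On an orthogonal basis these
values are the nonzero diagonal entries of the diagonal matrix representing `Q`. -/
def diagProd [DecidableEq K] {ι : Type*} [Fintype ι] (Q : QuadraticForm K E) (v : ι → E) : K :=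
  ∏ i, if Q (v i) = 0 then 1 else Q (v i)

open Classical in
/-- `Δ_Q`, the product of the nonzero entries of a diagonal matrix representing `Q`
(`1` if there are none). The diagonalization is a chosen one; the quadratic character of `Δ_Q`
does not depend on it, see `quadraticChar_diagProd_eq`. -/
noncomputable def disc [DecidableEq K] (Q : QuadraticForm K E) : K :=
  if h : ∃ v : Module.Basis (Fin (Module.finrank K E)) K E, (bilin Q).IsOrthoᵢ v then
    diagProd Q h.choose
  else 1

/-- The sign `ε_Q = η(Δ_Q)`, where `η` is the quadratic character of `K`. -/
noncomputable def sign [Fintype K] [DecidableEq K] (Q : QuadraticForm K E) : ℤ :=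
  quadraticChar K (disc Q)

/-- The normalized sign `ϵ` of `Q`, a quadratic form over the field `K` with `p ^ m` elements. -/
noncomputable def normSign [Fintype K] [DecidableEq K] (p m : ℕ) (Q : QuadraticForm K E) : ℤ :=
  if Even (rank Q) then sign Q * (-1) ^ ((p - 1) * m * rank Q / 4)
  else sign Q * (-1) ^ ((p - 1) * m * (rank Q + 1) / 4)

/-! The sign is well defined. -/

theorem bilin_self (h2 : (2 : K) ≠ 0) (Q : QuadraticForm K E) (x : E) : bilin Q x x = Q x := by
  have h : Q (x + x) = 4 * Q x := by
    rw [← two_smul K x, QuadraticMap.map_smul, smul_eq_mul]; ring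
  rw [bilin_apply, h]
  field_simp
  ring

theorem bilin_isSymm (Q : QuadraticForm K E) : LinearMap.IsSymm (bilin Q) := by
  refine ⟨fun x y => ?_⟩
  simp only [bilin_apply, RingHom.id_apply, add_comm x y]
  ring

theorem exists_isOrtho_basis [FiniteDimensional K E] (h2 : (2 : K) ≠ 0) (Q : QuadraticForm K E) :
    ∃ v : Module.Basis (Fin (Module.finrank K E)) K E, (bilin Q).IsOrthoᵢ v :=
  haveI := invertibleOfNonzero h2
  LinearMap.BilinForm.exists_orthogonal_basis (bilin_isSymm Q)

section WellDefined

variable [DecidableEq K] {ι κ : Type*} [Fintype ι] [Fintype κ]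

theorem diagProd_eq_prod_subtype (Q : QuadraticForm K E) (v : ι → E) :
    diagProd Q v = ∏ i : {i // Q (v i) ≠ 0}, Q (v i) := by
  rw [diagProd, ← Finset.prod_subtype (Finset.univ.filter fun i => Q (v i) ≠ 0) (by simp)
    (fun i => Q (v i)), Finset.prod_filter]
  exact Finset.prod_congr rfl fun i _ => by by_cases h : Q (v i) = 0 <;> simp [h]

open Matrix in
theorem diag_eq (h2 : (2 : K) ≠ 0) (Q : QuadraticForm K E) (v : Module.Basis ι K E)
    (w : Module.Basis κ K E) (hv : (bilin Q).IsOrthoᵢ v) (hw : (bilin Q).IsOrthoᵢ w)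
    [DecidableEq ι] [DecidableEq κ] :
    ∃ A : Matrix {j // Q (w j) ≠ 0} {i // Q (v i) ≠ 0} K, diagonal (fun j : {j // Q (w j) ≠ 0} => Q (w j)) =
      A * diagonal (fun i : {i // Q (v i) ≠ 0} => Q (v i)) * Aᵀ := by
  have key : ∀ x y : E, bilin Q x y =
      ∑ i : {i // Q (v i) ≠ 0}, v.repr x i * Q (v i) * v.repr y i := by
    intro x y
    have h1 : bilin Q x y = ∑ i, v.repr x i * Q (v i) * v.repr y i := by
      conv_lhs => rw [← v.sum_repr x, ← v.sum_repr y]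
      simp only [map_sum, map_smul, LinearMap.sum_apply, LinearMap.smul_apply, smul_eq_mul]
      refine Finset.sum_congr rfl fun i _ => ?_
      rw [Finset.sum_eq_single i]
      · rw [bilin_self h2]; ring
      · intro j _ hj
        have h0 : bilin Q (v j) (v i) = 0 := hv hj
        rw [h0, mul_zero]
      · simp
    rw [h1, ← Finset.sum_subtype (Finset.univ.filter fun i => Q (v i) ≠ 0) (by simp)
      (fun i => v.repr x i * Q (v i) * v.repr y i), Finset.sum_filter]
    exact Finset.sum_congr rfl fun i _ => by by_cases h : Q (v i) = 0 <;> simp [h]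
  refine ⟨of fun j i => v.repr (w j) i, ?_⟩
  ext j k
  rw [mul_apply]
  simp only [mul_diagonal, transpose_apply, of_apply]
  rw [← key, diagonal_apply]
  split_ifs with h
  · subst h; rw [bilin_self h2]
  · exact (hw fun e => h (Subtype.ext e)).symm

theorem card_le (h2 : (2 : K) ≠ 0) (Q : QuadraticForm K E) (v : Module.Basis ι K E)
    (w : Module.Basis κ K E) (hv : (bilin Q).IsOrthoᵢ v) (hw : (bilin Q).IsOrthoᵢ w) :
    Fintype.card {j // Q (w j) ≠ 0} ≤ Fintype.card {i // Q (v i) ≠ 0} := by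
  classical
  obtain ⟨A, hA⟩ := diag_eq h2 Q v w hv hw
  have h := congrArg Matrix.rank hA
  rw [Matrix.mul_assoc, Matrix.rank_of_isUnit _ (by
    rw [Matrix.isUnit_iff_isUnit_det, Matrix.det_diagonal]
    exact isUnit_iff_ne_zero.mpr (Finset.prod_ne_zero_iff.mpr fun j _ => j.2))] at h
  rw [h]
  exact (Matrix.rank_mul_le_left _ _).trans (Matrix.rank_le_card_width _)

/-- The quadratic character of the product of the nonzero diagonal entries is the same for all
diagonalizations of `Q`. -/
theorem quadraticChar_diagProd_eq [Fintype K] (h2 : (2 : K) ≠ 0) (Q : QuadraticForm K E)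
    (v : Module.Basis ι K E) (w : Module.Basis κ K E)
    (hv : (bilin Q).IsOrthoᵢ v) (hw : (bilin Q).IsOrthoᵢ w) :
    quadraticChar K (diagProd Q v) = quadraticChar K (diagProd Q w) := by
  classical
  let e : {j // Q (w j) ≠ 0} ≃ {i // Q (v i) ≠ 0} :=
    Fintype.equivOfCardEq (le_antisymm (card_le h2 Q v w hv hw) (card_le h2 Q w v hw hv))
  obtain ⟨A, h⟩ := diag_eq h2 Q v w hv hw
  have h' : (Matrix.diagonal fun j : {j // Q (w j) ≠ 0} => Q (w j)) =
      A.submatrix id e * (Matrix.diagonal fun j => Q (v (e j))) * (A.submatrix id e).transpose := by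
    rw [h, Matrix.transpose_submatrix,
      show (Matrix.diagonal fun j => Q (v (e j))) =
        (Matrix.diagonal fun i : {i // Q (v i) ≠ 0} => Q (v i)).submatrix e e from by
          rw [Matrix.submatrix_diagonal_equiv]; rfl,
      Matrix.submatrix_mul_equiv, Matrix.submatrix_mul_equiv, Matrix.submatrix_id_id]
  have hd := congrArg Matrix.det h'
  rw [Matrix.det_mul, Matrix.det_mul, Matrix.det_transpose, Matrix.det_diagonal,
    Matrix.det_diagonal, Equiv.prod_comp e fun i => Q (v i)] at hd
  rw [diagProd_eq_prod_subtype Q w, hd, diagProd_eq_prod_subtype Q v]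
  set d := (A.submatrix id e).det
  have hd0 : d ≠ 0 := by
    intro h0
    rw [h0, zero_mul, zero_mul] at hd
    exact Finset.prod_ne_zero_iff.mpr (fun j _ => j.2) hd
  rw [map_mul, map_mul, mul_right_comm, ← sq, quadraticChar_sq_one hd0, one_mul]

theorem sign_eq [Fintype K] [FiniteDimensional K E] (h2 : (2 : K) ≠ 0) (Q : QuadraticForm K E)
    (v : Module.Basis ι K E) (hv : (bilin Q).IsOrthoᵢ v) :
    sign Q = quadraticChar K (diagProd Q v) := by
  have h := exists_isOrtho_basis h2 Q
  rw [sign, disc, dif_pos h]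
  exact quadraticChar_diagProd_eq h2 Q _ v h.choose_spec hv

end WellDefined

end Forms

/-! ### The codes -/

section Codes

variable {K E₁ E₂ : Type*} [Field K] [Field E₁] [Field E₂] [Algebra K E₁] [Algebra K E₂]

/-- The word `(a Q(x) + Tr(b y) + c)_{(x, y)}`, as a `K`-linear function of `(a, b, c)`. -/
noncomputable def encode (Q : QuadraticForm K E₁) : (K × E₂ × K) →ₗ[K] (E₁ × E₂ → K) where
  toFun abc := fun xy => abc.1 * Q xy.1 + Algebra.trace K E₂ (abc.2.1 * xy.2) + abc.2.2
  map_add' s t := by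
    funext xy
    simp only [Prod.fst_add, Prod.snd_add, add_mul, map_add, Pi.add_apply]
    ring
  map_smul' k s := by
    funext xy
    simp only [Prod.smul_fst, Prod.smul_snd, smul_eq_mul, smul_mul_assoc, map_smul,
      Pi.smul_apply, RingHom.id_apply]
    ring

/-- The code `C'_Q = {(a Q(x) + Tr(b y) + c)_{(x, y) ∈ E₁ × E₂} : a ∈ K, b ∈ E₂, c ∈ K}`. -/
noncomputable def codeQ' (E₂ : Type*) [Field E₂] [Algebra K E₂] (Q : QuadraticForm K E₁) :
    Submodule K (E₁ × E₂ → K) :=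
  LinearMap.range (encode Q)

variable {p : ℕ} [Fact p.Prime] [Algebra (ZMod p) K]

/-- The map `Ψ : K → F_p^L`, `γ ↦ (Tr(γ θ^i))_{0 ≤ i < L}`, with the trace from `K` to `F_p`. -/
noncomputable def psi (p : ℕ) [Fact p.Prime] [Algebra (ZMod p) K] (L : ℕ) (θ : K) :
    K →ₗ[ZMod p] (Fin L → ZMod p) :=
  LinearMap.pi fun i => (Algebra.trace (ZMod p) K) ∘ₗ LinearMap.mulRight (ZMod p) (θ ^ (i : ℕ))

/-- The descended word `(ψ_{c_x})_x` of a word `c ∈ K^X`, as an `L × X` array over `F_p`. -/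
noncomputable def descendWord (p : ℕ) [Fact p.Prime] [Algebra (ZMod p) K] {X : Type*}
    (L : ℕ) (θ : K) : (X → K) →ₗ[ZMod p] (Fin L × X → ZMod p) :=
  LinearMap.pi fun ix => LinearMap.proj ix.1 ∘ₗ psi p L θ ∘ₗ LinearMap.proj ix.2

theorem descendWord_apply {X : Type*} (L : ℕ) (θ : K) (c : X → K) (i : Fin L) (x : X) :
    descendWord p L θ c (i, x) = Algebra.trace (ZMod p) K (c x * θ ^ (i : ℕ)) := rfl

/-- The descended code `{(ψ_{c_x})_x : c ∈ C}` over `F_p` of a `K`-linear code `C ⊆ K^X`. -/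
noncomputable def descend (p : ℕ) [Fact p.Prime] [Algebra (ZMod p) K] {X : Type*}
    (L : ℕ) (θ : K) (C : Submodule K (X → K)) : Submodule (ZMod p) (Fin L × X → ZMod p) :=
  (C.restrictScalars (ZMod p)).map (descendWord p L θ)

end Codes

end QuadCode

set_option linter.unusedSectionVars false

/-! Let `V = K × E₂ × K`, of dimension `m * (m₂ + 2)` over the prime field, be the space of
parameters `(a, b, c)`. It embeds in the descended code, so the weights are minima of support sizes
over `r`-dimensional `H ≤ V`. The coprimality condition makes the products of `F_p^*` with the
powers of `θ` cover `Kˣ` uniformly, so `N` times a support size is `traceSupp Q H`, in which `θ^i`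
is replaced by an arbitrary `z ∈ K`. Let `n` be the largest fibre size of `Q`, attained at `t₀`. Two
counts of `traceSupp` give the theorem.

Primal count (`natCard_mul_traceSupp`): `|H| * traceSupp` is `q` times the sum of the weights of the
words of `H`. A nonzero word has at most `|E₂| * n` zeros, with equality for the words `a * (Q x -
t₀)`. These form a space of dimension `m`, which settles `r ≤ m`.

Dual count (`traceSupp_add_sum`): `(z, x, y)` is outside the support iff `(z * Q x, z • y, z)` lies
in the orthogonal complement `P` of `H`. The triples with `z = 0` are all outside, and `(α, β, γ) ∈
P` with `γ ≠ 0` accounts for the fibre of `Q` over `α / γ`, of size at most `n`. The number of such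
vectors is at most `|P| - 1` and at most `(1 - 1/q) * |P|`. Equality holds for `P = {(t₀ γ, β, γ) :
β ∈ B, γ ∈ G}`, with `B = 0` when `r > m * (m₂ + 1)` and with `G = K` in the middle range.

There remains `n * q = q ^ m₁ * (1 + ω)`. Diagonalizing `Q` and summing quadratic characters gives,
for the rank `R`, `ω = q^(-R/2) * (q - 1)` or `q^(-R/2)` for even `R` according to the sign, and
`q^((1-R)/2)` for odd `R`. -/

namespace QuadCode

/-! ### Quadratic character sums and representation numbers of diagonal forms. -/

section CharSums

variable {K : Type*} [Field K] [Fintype K] [DecidableEq K]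

theorem sum_quadraticChar_sq_sub (h2 : ringChar K ≠ 2) {c : K} (hc : c ≠ 0) :
    ∑ y : K, quadraticChar K (y ^ 2 - c) = -1 := by
  have two : (2 : K) ≠ 0 := Ring.two_ne_zero h2
  have h1 : ∀ y : K, ((Finset.univ.filter fun x : K => x ^ 2 = y ^ 2 - c).card : ℤ) =
      quadraticChar K (y ^ 2 - c) + 1 := by
    intro y
    rw [← quadraticChar_card_sqrts h2]
    congr 2
    ext x
    simp
  -- The hyperbola `(y - x) * (y + x) = c` is parametrized by `u = y - x ≠ 0`, with `y + x = c / u`.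
  have h3 : (Finset.univ.filter fun w : K × K => w.2 ^ 2 = w.1 ^ 2 - c).card =
      (Finset.univ.filter fun u : K => u ≠ 0).card := by
    refine Finset.card_bij' (fun w _ => w.1 - w.2) (fun u _ => ((u + c / u) / 2, (c / u - u) / 2))
      ?_ ?_ ?_ ?_
    · rintro ⟨y, x⟩ h
      simp only [Finset.mem_filter, Finset.mem_univ, true_and] at h ⊢
      intro h0
      apply hc
      linear_combination (y + x) * h0 + h
    · intro u h
      simp only [Finset.mem_filter, Finset.mem_univ, true_and] at h ⊢
      field_simp
      ring
    · rintro ⟨y, x⟩ h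
      simp only [Finset.mem_filter, Finset.mem_univ, true_and] at h
      have h0 : y - x ≠ 0 := by
        intro h0
        apply hc
        linear_combination (y + x) * h0 + h
      have hcu : c / (y - x) = y + x := by
        rw [div_eq_iff h0]
        linear_combination h
      ext
      · simp only [hcu]; field_simp; ring
      · simp only [hcu]; field_simp; ring
    · intro u h
      simp only [Finset.mem_filter, Finset.mem_univ, true_and] at h
      field_simp
      ring
  have h4 : (Finset.univ.filter fun w : K × K => w.2 ^ 2 = w.1 ^ 2 - c).card =
      ∑ y : K, (Finset.univ.filter fun x : K => x ^ 2 = y ^ 2 - c).card := by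
    simp only [Finset.card_filter, Fintype.sum_prod_type]
  have h5 : (Finset.univ.filter fun u : K => u ≠ 0).card + 1 = Fintype.card K := by
    rw [Finset.filter_ne', Finset.card_erase_add_one (Finset.mem_univ _), Finset.card_univ]
  have h6 : ((Finset.univ.filter fun u : K => u ≠ 0).card : ℤ) =
      ∑ y : K, (quadraticChar K (y ^ 2 - c) + 1) := by
    rw [← h3, h4]
    push_cast
    exact Finset.sum_congr rfl fun y _ => h1 y
  rw [Finset.sum_add_distrib] at h6
  simp only [Finset.sum_const, Finset.card_univ, nsmul_eq_mul, mul_one] at h6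
  have h7 : ((Finset.univ.filter fun u : K => u ≠ 0).card : ℤ) + 1 = Fintype.card K := by
    exact_mod_cast h5
  linarith

theorem sum_quadraticChar_sub_mul_sq (h2 : ringChar K ≠ 2) {a : K} (ha : a ≠ 0) (t : K) :
    ∑ y : K, quadraticChar K (t - a * y ^ 2) =
      quadraticChar K (-a) * if t = 0 then (Fintype.card K : ℤ) - 1 else -1 := by
  have h : ∀ y : K, quadraticChar K (t - a * y ^ 2) =
      quadraticChar K (-a) * quadraticChar K (y ^ 2 - t / a) := by
    intro y
    rw [← map_mul]
    congr 1
    field_simp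
    ring
  simp only [h, ← Finset.mul_sum]
  congr 1
  split_ifs with h0
  · subst h0
    have : ∀ y : K, quadraticChar K (y ^ 2 - 0 / a) = if y = 0 then 0 else 1 := by
      intro y
      split_ifs with hy
      · simp [hy]
      · simpa using quadraticChar_sq_one' hy
    simp only [this]
    rw [Finset.sum_ite]
    simp only [Finset.sum_const_zero, zero_add, Finset.sum_const, nsmul_eq_mul, mul_one]
    rw [Finset.filter_ne', Finset.card_erase_of_mem (Finset.mem_univ _), Finset.card_univ,
      Nat.cast_sub Fintype.card_pos, Nat.cast_one]
  · exact sum_quadraticChar_sq_sub h2 (div_ne_zero h0 ha)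

/-- The number of `y` with `a * y ^ 2 = t`. -/
theorem card_mul_sq_eq (h2 : ringChar K ≠ 2) {a : K} (ha : a ≠ 0) (t : K) :
    ((Finset.univ.filter fun y : K => t - a * y ^ 2 = 0).card : ℤ) =
      quadraticChar K (a * t) + 1 := by
  have h : quadraticChar K (a * t) = quadraticChar K (t / a) := by
    have : a * t = a ^ 2 * (t / a) := by field_simp
    rw [this, map_mul, quadraticChar_sq_one' ha, one_mul]
  rw [h, ← quadraticChar_card_sqrts h2]
  congr 2
  ext y
  simp only [Finset.mem_filter, Finset.mem_univ, true_and, Set.mem_toFinset, Set.mem_ofPred_eq,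
    eq_div_iff ha, sub_eq_zero]
  constructor <;> intro h <;> linear_combination -h

/-- The number of representations of `t` by the diagonal form with coefficients `a`. -/
def diagCount {n : ℕ} (a : Fin n → K) (t : K) : ℕ :=
  (Finset.univ.filter fun x : Fin n → K => ∑ i, a i * x i ^ 2 = t).card

theorem diagCount_succ {n : ℕ} (a : Fin (n + 1) → K) (t : K) :
    diagCount a t = ∑ y : K, diagCount (fun i => a i.succ) (t - a 0 * y ^ 2) := by
  simp only [diagCount, Finset.card_filter]
  rw [← (Fin.consEquiv fun _ => K).sum_comp, Fintype.sum_prod_type]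
  refine Finset.sum_congr rfl fun y _ => Finset.sum_congr rfl fun x _ => ?_
  simp [Fin.consEquiv, Fin.sum_univ_succ, eq_sub_iff_add_eq, add_comm]

/-- Induction removes the first variable. A zero coefficient multiplies the count by `q`; a nonzero
one changes the parity of the rank. Going from odd to even rank sums `χ (t - a y²)`; going from even
to odd rank counts the solutions of `a y² = t`. The factor `q ^ (k + 1)` keeps everything integral.
-/
theorem diagCount_formula (h2 : ringChar K ≠ 2) {n : ℕ} (a : Fin n → K) :
    ∀ k : ℕ,
      (Fintype.card {i // a i ≠ 0} = 2 * k → ∀ t, (diagCount a t : ℤ) * Fintype.card K ^ (k + 1) =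
        Fintype.card K ^ n * (Fintype.card K ^ k +
          quadraticChar K ((-1) ^ k * ∏ i, if a i = 0 then 1 else a i) *
            if t = 0 then (Fintype.card K : ℤ) - 1 else -1)) ∧
      (Fintype.card {i // a i ≠ 0} = 2 * k + 1 → ∀ t,
        (diagCount a t : ℤ) * Fintype.card K ^ (k + 1) = Fintype.card K ^ n * (Fintype.card K ^ k +
          quadraticChar K ((-1) ^ k * (∏ i, if a i = 0 then 1 else a i) * t))) := by
  induction n with
  | zero =>
    intro k
    have h0 : Fintype.card {i // a i ≠ 0} = 0 := by simp
    refine ⟨fun h t => ?_, fun h => by omega⟩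
    obtain rfl : k = 0 := by omega
    by_cases ht : t = 0 <;> simp [diagCount, ht, eq_comm]
  | succ n ih =>
    intro k
    have hcard : Fintype.card {i // a i ≠ 0} =
        (if a 0 = 0 then 0 else 1) + Fintype.card {i : Fin n // a i.succ ≠ 0} := by
      simp only [Fintype.card_subtype, Finset.card_filter, Fin.sum_univ_succ]
      congr 1
      by_cases h : a 0 = 0 <;> simp [h]
    rw [hcard, Fin.prod_univ_succ]
    by_cases h0 : a 0 = 0
    · have hc : ∀ t, (diagCount a t : ℤ) =
          Fintype.card K * diagCount (fun i => a i.succ) t := by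
        intro t
        rw [diagCount_succ]
        simp [h0]
      simp only [h0, if_true, zero_add, one_mul, hc]
      refine ⟨fun h t => ?_, fun h t => ?_⟩
      · have := (ih (fun i => a i.succ) k).1 h t
        rw [mul_assoc, this]; ring
      · have := (ih (fun i => a i.succ) k).2 h t
        rw [mul_assoc, this]; ring
    · simp only [h0, if_false]
      set d : K := ∏ i : Fin n, if a i.succ = 0 then 1 else a i.succ with hd
      refine ⟨fun h t => ?_, fun h t => ?_⟩
      -- The first coefficient is nonzero, so the even rank is positive and the remaining form has
      -- rank `2k + 1` for the lowered `k`.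
      · obtain ⟨k, rfl⟩ : ∃ j, k = j + 1 := ⟨k - 1, by omega⟩
        have H := (ih (fun i => a i.succ) k).2 (by omega)
        rw [diagCount_succ]
        push_cast
        rw [pow_succ, ← mul_assoc, Finset.sum_mul, Finset.sum_congr rfl fun y _ => H _,
          ← Finset.mul_sum, Finset.sum_add_distrib]
        simp only [map_mul, ← Finset.mul_sum, sum_quadraticChar_sub_mul_sq h2 h0, Finset.sum_const,
          Finset.card_univ, nsmul_eq_mul, neg_eq_neg_one_mul (a 0), pow_succ (-1 : K), ← hd]
        ring
      · have H := (ih (fun i => a i.succ) k).1 (by omega)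
        have hs : ∑ y : K, (if t - a 0 * y ^ 2 = 0 then (Fintype.card K : ℤ) - 1 else -1) =
            Fintype.card K * quadraticChar K (a 0 * t) := by
          have : ∀ y : K, (if t - a 0 * y ^ 2 = 0 then (Fintype.card K : ℤ) - 1 else -1) =
              Fintype.card K * (if t - a 0 * y ^ 2 = 0 then 1 else 0) - 1 := by
            intro y; split_ifs <;> ring
          simp only [this, Finset.sum_sub_distrib, ← Finset.mul_sum]
          rw [Finset.sum_boole, card_mul_sq_eq h2 h0]
          simp only [Finset.sum_const, Finset.card_univ, nsmul_eq_mul]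
          ring
        rw [diagCount_succ]
        push_cast
        rw [Finset.sum_mul, Finset.sum_congr rfl fun y _ => H _, ← Finset.mul_sum,
          Finset.sum_add_distrib, ← Finset.mul_sum, hs]
        simp only [map_mul, Finset.sum_const, Finset.card_univ, nsmul_eq_mul, ← hd]
        ring

end CharSums

/-! ### Fibre sizes of a quadratic form in terms of its rank and sign. -/

section Count

variable {K E : Type*} [Field K] [Fintype K] [DecidableEq K] [AddCommGroup E] [Module K E]

theorem bilin_repr {ι : Type*} [Fintype ι] (h2 : (2 : K) ≠ 0) (Q : QuadraticForm K E)
    (v : Module.Basis ι K E) (hv : (bilin Q).IsOrthoᵢ v) (x y : E) :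
    bilin Q x y = ∑ i, v.repr x i * Q (v i) * v.repr y i := by
  conv_lhs => rw [← v.sum_repr x, ← v.sum_repr y]
  simp only [map_sum, map_smul, LinearMap.sum_apply, LinearMap.smul_apply, smul_eq_mul]
  refine Finset.sum_congr rfl fun i _ => ?_
  rw [Finset.sum_eq_single i]
  · rw [bilin_self h2]; ring
  · intro j _ hj
    have h0 : bilin Q (v j) (v i) = 0 := hv hj
    rw [h0, mul_zero]
  · simp

theorem rank_eq_card {ι : Type*} [Fintype ι] (h2 : (2 : K) ≠ 0) (Q : QuadraticForm K E)
    (v : Module.Basis ι K E) (hv : (bilin Q).IsOrthoᵢ v) :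
    rank Q = Fintype.card {i // Q (v i) ≠ 0} := by
  classical
  -- In orthogonal coordinates the radical is the kernel of the diagonal matrix, whose rank is the
  -- number of nonzero entries.
  have hk : LinearMap.ker (bilin Q) =
      (LinearMap.ker (Matrix.toLin' (Matrix.diagonal fun i => Q (v i)))).comap
        (v.equivFun : E →ₗ[K] ι → K) := by
    ext x
    simp only [LinearMap.mem_ker, Submodule.mem_comap, LinearEquiv.coe_coe, Matrix.toLin'_apply]
    constructor
    · intro h
      funext i
      have := bilin_repr h2 Q v hv x (v i)
      rw [h, LinearMap.zero_apply, Finset.sum_eq_single i] at this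
      · simpa [Matrix.mulVec_diagonal, mul_comm] using this.symm
      · intro j _ hj
        simp [v.repr_self, hj.symm]
      · simp
    · intro h
      ext y
      rw [bilin_repr h2 Q v hv, LinearMap.zero_apply]
      refine Finset.sum_eq_zero fun i _ => ?_
      have := congrFun h i
      simp only [Matrix.mulVec_diagonal, Module.Basis.equivFun_apply, Pi.zero_apply] at this
      rw [mul_comm (v.repr x i), this, zero_mul]
  have hf : Module.finrank K (LinearMap.ker (bilin Q)) =
      Module.finrank K (LinearMap.ker (Matrix.toLin' (Matrix.diagonal fun i => Q (v i)))) := by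
    rw [hk]
    exact (v.equivFun.ofSubmodule' _).finrank_eq
  have hr := LinearMap.finrank_range_add_finrank_ker
    (Matrix.toLin' (Matrix.diagonal fun i => Q (v i)))
  rw [← hf, Matrix.toLin'_apply', ← Matrix.rank, Matrix.rank_diagonal, Module.finrank_pi,
    ← Module.finrank_eq_card_basis v] at hr
  rw [rank]
  omega

theorem natCard_eq_diagCount {n : ℕ} (h2 : (2 : K) ≠ 0) (Q : QuadraticForm K E)
    (v : Module.Basis (Fin n) K E) (hv : (bilin Q).IsOrthoᵢ v) (t : K) :
    Nat.card {x // Q x = t} = diagCount (fun i => Q (v i)) t := by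
  rw [diagCount, ← Fintype.card_subtype, ← Nat.card_eq_fintype_card]
  refine Nat.card_congr (v.equivFun.toEquiv.subtypeEquiv fun x => ?_)
  rw [← bilin_self h2 Q x, bilin_repr h2 Q v hv]
  refine Eq.congr (Finset.sum_congr rfl fun i _ => ?_) rfl
  simp only [LinearEquiv.coe_toEquiv, Module.Basis.equivFun_apply]
  ring

variable [FiniteDimensional K E]

theorem natCard_of_rank_even (h2 : ringChar K ≠ 2) (Q : QuadraticForm K E) {k : ℕ}
    (hk : rank Q = 2 * k) (t : K) :
    (Nat.card {x // Q x = t} : ℤ) * Fintype.card K ^ (k + 1) =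
      Fintype.card K ^ Module.finrank K E * (Fintype.card K ^ k +
        quadraticChar K (-1) ^ k * sign Q * if t = 0 then (Fintype.card K : ℤ) - 1 else -1) := by
  have two := Ring.two_ne_zero h2
  obtain ⟨v, hv⟩ := exists_isOrtho_basis two Q
  rw [natCard_eq_diagCount two Q v hv, sign_eq two Q v hv,
    (diagCount_formula h2 _ k).1 ((rank_eq_card two Q v hv).symm.trans hk), map_mul, map_pow,
    diagProd]

/-- Here `d` is `(-1)^k` times the discriminant. Only `d ≠ 0` is recorded: another value of `d`
merely permutes the fibre sizes, so the maximum does not depend on the sign of `Q`. -/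
theorem natCard_of_rank_odd (h2 : ringChar K ≠ 2) (Q : QuadraticForm K E) {k : ℕ}
    (hk : rank Q = 2 * k + 1) :
    ∃ d : K, d ≠ 0 ∧ ∀ t, (Nat.card {x // Q x = t} : ℤ) * Fintype.card K ^ (k + 1) =
      Fintype.card K ^ Module.finrank K E * (Fintype.card K ^ k + quadraticChar K (d * t)) := by
  have two := Ring.two_ne_zero h2
  obtain ⟨v, hv⟩ := exists_isOrtho_basis two Q
  refine ⟨(-1) ^ k * diagProd Q v, mul_ne_zero (pow_ne_zero _ (neg_ne_zero.2 one_ne_zero)) ?_,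
    fun t => ?_⟩
  · refine Finset.prod_ne_zero_iff.2 fun i _ => ?_
    split_ifs with h
    exacts [one_ne_zero, h]
  · rw [natCard_eq_diagCount two Q v hv,
      (diagCount_formula h2 _ k).2 ((rank_eq_card two Q v hv).symm.trans hk), diagProd]

theorem sign_sq (h2 : ringChar K ≠ 2) (Q : QuadraticForm K E) : sign Q = 1 ∨ sign Q = -1 := by
  have two := Ring.two_ne_zero h2
  obtain ⟨v, hv⟩ := exists_isOrtho_basis two Q
  rw [sign_eq two Q v hv]
  refine quadraticChar_dichotomy (Finset.prod_ne_zero_iff.2 fun i _ => ?_)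
  split_ifs with h
  exacts [one_ne_zero, h]

theorem rank_pos (h2 : ringChar K ≠ 2) {Q : QuadraticForm K E} (hQ : Q ≠ 0) : 0 < rank Q := by
  have two := Ring.two_ne_zero h2
  rw [Nat.pos_iff_ne_zero]
  intro h
  apply hQ
  have hker : LinearMap.ker (bilin Q) = ⊤ := by
    apply Submodule.eq_top_of_finrank_eq
    have := Submodule.finrank_le (LinearMap.ker (bilin Q))
    rw [rank] at h
    omega
  ext x
  rw [← bilin_self two Q x, LinearMap.ker_eq_top.1 hker]
  rfl

end Count

/-! ### Counting with orthogonal complements. -/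

section Duality

variable {F V W : Type*} [Field F] [Fintype F] [AddCommGroup V] [Module F V]

theorem natCard_mul_natCard_orthogonal [Finite V] {B : LinearMap.BilinForm F V}
    (hB : B.Nondegenerate) (W : Submodule F V) :
    Nat.card W * Nat.card (B.orthogonal W) = Nat.card V := by
  have := Submodule.finrank_le W
  rw [Module.natCard_eq_pow_finrank (K := F), Module.natCard_eq_pow_finrank (K := F) (V := V),
    Module.natCard_eq_pow_finrank (K := F) (V := B.orthogonal W),
    LinearMap.BilinForm.finrank_orthogonal hB, ← pow_add]
  congr 1
  omega

theorem natCard_range_mul_natCard_ker [AddCommGroup W] [Module F W] [Finite V] (l : V →ₗ[F] W) :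
    Nat.card (LinearMap.range l) * Nat.card (LinearMap.ker l) = Nat.card V := by
  rw [Module.natCard_eq_pow_finrank (K := F), Module.natCard_eq_pow_finrank (K := F) (V := V),
    Module.natCard_eq_pow_finrank (K := F) (V := LinearMap.ker l), ← pow_add,
    LinearMap.finrank_range_add_finrank_ker]

theorem natCard_not_mem_add {V : Type*} [Finite V] (s : Set V) :
    Nat.card {z // z ∉ s} + Nat.card s = Nat.card V := by
  rw [add_comm]
  exact Set.ncard_add_ncard_compl s

/-- For a linear map `l : V → K`, the number of elements of `K` that pair nontrivially with the
image of `l` and the number of elements of `V` outside the kernel of `l` are proportional. -/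
theorem natCard_mul_natCard_not_orthogonal [AddCommGroup W] [Module F W] [Finite V] [Finite W]
    {B : LinearMap.BilinForm F W} (hB : B.Nondegenerate) (l : V →ₗ[F] W) :
    Nat.card V * Nat.card {z : W // ∃ h, B (l h) z ≠ 0} =
      Nat.card W * Nat.card {h : V // l h ≠ 0} := by
  have h1 := natCard_mul_natCard_orthogonal hB (LinearMap.range l)
  have h2 := natCard_range_mul_natCard_ker l
  have h3 : Nat.card {z : W // ∃ h, B (l h) z ≠ 0} +
      Nat.card (B.orthogonal (LinearMap.range l)) = Nat.card W := by
    rw [← natCard_not_mem_add (B.orthogonal (LinearMap.range l) : Set W)]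
    congr 1
    refine Nat.card_congr (Equiv.subtypeEquivRight fun z => ?_)
    simp [LinearMap.BilinForm.mem_orthogonal_iff]
  have h4 : Nat.card {h : V // l h ≠ 0} + Nat.card (LinearMap.ker l) = Nat.card V := by
    rw [← natCard_not_mem_add (LinearMap.ker l : Set V)]
    rfl
  -- The complementary counts agree, as `|range| * |ker| = |V|` and `|range| * |range^⊥| = |W|`;
  -- subtracting from `|V| * |W|` gives the claim.
  have h5 : Nat.card V * Nat.card (B.orthogonal (LinearMap.range l)) =
      Nat.card W * Nat.card (LinearMap.ker l) := by
    rw [← h1, ← h2]; ring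
  nlinarith

end Duality

/-! ### From powers of `θ` to all units. -/

section UnitSum

variable {p : ℕ} [Fact p.Prime] {K : Type*} [Field K] [Fintype K] [DecidableEq K]
  [Algebra (ZMod p) K]

/-- Every nonzero element of `K` is, in the same number of ways, the product of an element of the
prime field and a power of `θ`; summing a function that is invariant under the prime field over the
powers of `θ` therefore gives its sum over `Kˣ` divided by `N`. -/
theorem mul_sum_pow_eq_sum_units {N : ℕ} (hN : N ∣ p - 1)
    (hN' : Nat.Coprime N ((Fintype.card K - 1) / (p - 1)))
    {θ : K} (hθ : IsPrimitiveRoot θ ((Fintype.card K - 1) / N)) (f : K → ℕ)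
    (hf : ∀ (c : ZMod p) (z : K), c ≠ 0 → f (c • z) = f z) :
    N * ∑ i : Fin ((Fintype.card K - 1) / N), f (θ ^ (i : ℕ)) = ∑ z : Kˣ, f z := by
  classical
  set q := Fintype.card K with hq
  have hp : 1 < p := (Fact.out : p.Prime).one_lt
  have hq1 : 1 < q := Fintype.one_lt_card
  have hKu : Fintype.card Kˣ = q - 1 := by rw [Fintype.card_units]
  have hFu : Fintype.card (ZMod p)ˣ = p - 1 := ZMod.card_units p
  let j : (ZMod p)ˣ →* Kˣ := Units.map (algebraMap (ZMod p) K : ZMod p →* K)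
  have hj : Function.Injective j := Units.map_injective (algebraMap (ZMod p) K).injective
  have hpq : p - 1 ∣ q - 1 := by
    rw [← hFu, ← hKu, ← Nat.card_eq_fintype_card, ← Nat.card_eq_fintype_card]
    exact Subgroup.card_dvd_of_injective j hj
  have hNq : N ∣ q - 1 := hN.trans hpq
  have hN0 : 0 < N := Nat.pos_of_dvd_of_pos hN (by omega)
  set l := (q - 1) / N with hl
  have hNl : N * l = q - 1 := Nat.mul_div_cancel' hNq
  have hl0 : l ≠ 0 := by rintro h; rw [h] at hNl; omega
  have : NeZero l := ⟨hl0⟩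
  obtain ⟨u, hu⟩ : ∃ u : Kˣ, (u : K) = θ := ⟨(hθ.isUnit hl0).unit, rfl⟩
  have hup : IsPrimitiveRoot u l := by rw [← hu] at hθ; exact IsPrimitiveRoot.coe_units_iff.1 hθ
  let φ : (ZMod p)ˣ × Subgroup.zpowers u →* Kˣ := j.coprod (Subgroup.zpowers u).subtype
  have hzc : Nat.card (Subgroup.zpowers u) = l := by rw [Nat.card_zpowers, hup.eq_orderOf]
  -- The range contains the powers of `θ`, of index `N`, and the prime field units, of index `(q -
  -- 1) / (p - 1)`. Its index divides both, and they are coprime.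
  have hsurj : Function.Surjective φ := by
    rw [← MonoidHom.range_eq_top, ← Subgroup.index_eq_one]
    have i1 : φ.range.index ∣ N := by
      have h1 : Subgroup.zpowers u ≤ φ.range := fun z hz => ⟨(1, ⟨z, hz⟩), by simp [φ]⟩
      have h2 := (Subgroup.zpowers u).card_mul_index
      rw [hzc, Nat.card_eq_fintype_card, hKu, ← hNl, mul_comm] at h2
      rw [← Nat.eq_of_mul_eq_mul_right (Nat.pos_of_ne_zero hl0) h2]
      exact Subgroup.index_dvd_of_le h1
    have i2 : φ.range.index ∣ (q - 1) / (p - 1) := by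
      have h1 : j.range ≤ φ.range := by
        rintro _ ⟨c, rfl⟩
        exact ⟨(c, 1), by simp [φ]⟩
      have h2 := j.range.card_mul_index
      rw [Nat.card_congr (MonoidHom.ofInjective hj).symm.toEquiv, Nat.card_eq_fintype_card, hFu,
        Nat.card_eq_fintype_card, hKu] at h2
      rw [← h2, Nat.mul_div_cancel_left _ (by omega)]
      exact Subgroup.index_dvd_of_le h1
    exact Nat.eq_one_of_dvd_coprimes hN' i1 i2
  obtain ⟨c, hc⟩ : ∃ c : ℕ, ∀ z : Kˣ, (Finset.univ.filter fun g => φ g = z).card = c :=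
    ⟨_, fun z => MonoidHom.card_fiber_eq_of_mem_range φ (hsurj z) (hsurj 1)⟩
  have hsum : ∀ g : Kˣ → ℕ, ∑ x, g (φ x) = c * ∑ z, g z := by
    intro g
    rw [← Finset.sum_fiberwise_of_maps_to (g := φ) (t := Finset.univ) (by simp), Finset.mul_sum]
    refine Finset.sum_congr rfl fun z _ => ?_
    rw [Finset.sum_congr rfl (g := fun _ => g z)
      (fun x hx => by rw [(Finset.mem_filter.1 hx).2]), Finset.sum_const, hc, smul_eq_mul]
  -- The common fibre size `c` is found by summing the constant function `1`.
  have hcN : c * N = p - 1 := by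
    have h1 := hsum fun _ => 1
    simp only [Finset.sum_const, Finset.card_univ, smul_eq_mul, mul_one, Fintype.card_prod, hFu,
      hKu] at h1
    rw [← Nat.card_eq_fintype_card, hzc, ← hNl, ← mul_assoc] at h1
    exact (Nat.eq_of_mul_eq_mul_right (Nat.pos_of_ne_zero hl0) h1).symm
  have hc0 : 0 < c := by
    rw [Nat.pos_iff_ne_zero]
    rintro rfl
    omega
  have h1 := hsum fun z => f z
  have h2 : ∀ x : (ZMod p)ˣ × Subgroup.zpowers u, f (φ x : Kˣ) = f ((x.2 : Kˣ) : K) := by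
    rintro ⟨a, b⟩
    have : ((φ (a, b) : Kˣ) : K) = (a : ZMod p) • ((b : Kˣ) : K) := by
      simp [φ, j, Algebra.smul_def]
    rw [this, hf _ _ a.ne_zero]
  have h3 : ∑ b : Subgroup.zpowers u, f ((b : Kˣ) : K) =
      ∑ i : Fin l, f (θ ^ (i : ℕ)) := by
    have ho : orderOf u = l := hup.eq_orderOf.symm
    rw [← (finEquivZPowers (isOfFinOrder_of_finite u)).sum_comp, ← (finCongr ho).sum_comp]
    refine Finset.sum_congr rfl fun i _ => ?_
    simp [finEquivZPowers_apply, hu]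
  simp only [h2, Fintype.sum_prod_type, h3, Finset.sum_const, Finset.card_univ, smul_eq_mul, hFu,
    ← hcN, mul_assoc] at h1
  exact Nat.eq_of_mul_eq_mul_left hc0 h1

end UnitSum

theorem exists_submodule_finrank_eq {F V : Type*} [Field F] [AddCommGroup V] [Module F V]
    {n : ℕ} (hn : n ≤ Module.finrank F V) : ∃ W : Submodule F V, Module.finrank F W = n := by
  obtain ⟨f, hf⟩ := exists_linearIndependent_of_le_finrank hn
  exact ⟨Submodule.span F (Set.range f), by rw [finrank_span_eq_card hf, Fintype.card_fin]⟩

theorem natCard_subtype_prod {A B : Type*} [Fintype A] [Finite B] (P : A → B → Prop) :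
    Nat.card {w : A × B // P w.1 w.2} = ∑ a, Nat.card {b // P a b} := by
  rw [← Nat.card_sigma]
  exact Nat.card_congr (Equiv.subtypeProdEquivSigmaSubtype P)

theorem natCard_subtype_prod' {A B : Type*} [Finite A] [Fintype B] (P : A → B → Prop) :
    Nat.card {w : A × B // P w.1 w.2} = ∑ b, Nat.card {a // P a b} := by
  rw [← natCard_subtype_prod fun b a => P a b]
  exact Nat.card_congr ((Equiv.prodComm A B).subtypeEquiv fun w => Iff.rfl)

/-! ### Two counts of the support of a subcode. -/

section Code

variable {p : ℕ} [Fact p.Prime] {K E₁ E₂ : Type*} [Field K] [Fintype K] [Algebra (ZMod p) K]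
  [Field E₁] [Algebra K E₁] [Field E₂] [Algebra K E₂] [Algebra (ZMod p) E₂]
  [IsScalarTower (ZMod p) K E₂]

theorem encode_apply (Q : QuadraticForm K E₁) (h : K × E₂ × K) (w : E₁ × E₂) :
    encode Q h w = h.1 * Q w.1 + Algebra.trace K E₂ (h.2.1 * w.2) + h.2.2 := rfl

variable [Finite E₂]

variable (p K E₂) in
/-- The pairing `((a, b, c), (α, β, γ)) ↦ Tr (a α) + Tr (b β) + Tr (c γ)` with values in the prime
field. -/
noncomputable def pairing : LinearMap.BilinForm (ZMod p) (K × E₂ × K) :=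
  (Algebra.traceForm (ZMod p) K).comp (LinearMap.fst _ _ _) (LinearMap.fst _ _ _) +
    ((Algebra.traceForm (ZMod p) E₂).comp (LinearMap.fst _ _ _ ∘ₗ LinearMap.snd _ _ _)
      (LinearMap.fst _ _ _ ∘ₗ LinearMap.snd _ _ _) +
    (Algebra.traceForm (ZMod p) K).comp (LinearMap.snd _ _ _ ∘ₗ LinearMap.snd _ _ _)
      (LinearMap.snd _ _ _ ∘ₗ LinearMap.snd _ _ _))

theorem pairing_apply (h v : K × E₂ × K) :
    pairing p K E₂ h v = Algebra.trace (ZMod p) K (h.1 * v.1) +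
      (Algebra.trace (ZMod p) E₂ (h.2.1 * v.2.1) + Algebra.trace (ZMod p) K (h.2.2 * v.2.2)) :=
  rfl

theorem pairing_isRefl : LinearMap.BilinForm.IsRefl (pairing p K E₂) := by
  intro h v hv
  rw [pairing_apply] at hv ⊢
  rw [← hv, mul_comm v.1, mul_comm v.2.1, mul_comm v.2.2]

theorem pairing_nondegenerate : LinearMap.BilinForm.Nondegenerate (pairing p K E₂) := by
  refine (LinearMap.IsRefl.nondegenerate_iff_separatingLeft (B := pairing p K E₂)
    pairing_isRefl).2 ?_
  rintro ⟨a, b, c⟩ h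
  have h1 : a = 0 := (traceForm_nondegenerate (ZMod p) K).1 a fun x => by
    simpa [pairing_apply] using h (x, 0, 0)
  have h2 : b = 0 := (traceForm_nondegenerate (ZMod p) E₂).1 b fun x => by
    simpa [pairing_apply] using h (0, x, 0)
  have h3 : c = 0 := (traceForm_nondegenerate (ZMod p) K).1 c fun x => by
    simpa [pairing_apply] using h (0, 0, x)
  rw [h1, h2, h3]; rfl

/-- The evaluation of the words at a position, paired with `z`, is the pairing with a vector. -/
theorem trace_encode_mul (Q : QuadraticForm K E₁) (h : K × E₂ × K) (w : E₁ × E₂) (z : K) :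
    Algebra.trace (ZMod p) K (encode Q h w * z) =
      pairing p K E₂ h (z * Q w.1, z • w.2, z) := by
  -- Transitivity of the trace in the tower `F_p ⊆ K ⊆ E₂`.
  have h1 : Algebra.trace (ZMod p) E₂ (h.2.1 * z • w.2) =
      Algebra.trace (ZMod p) K (z * Algebra.trace K E₂ (h.2.1 * w.2)) := by
    rw [← Algebra.trace_trace (S := K), mul_smul_comm, map_smul, smul_eq_mul]
  rw [pairing_apply, h1, encode_apply, ← map_add, ← map_add]
  congr 1
  ring

/-- The number of triples `(z, x, y)` such that some parameter in `H` gives a word whose value at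
`(x, y)` has a product with `z` of nonzero trace. -/
noncomputable def traceSupp (Q : QuadraticForm K E₁) (H : Submodule (ZMod p) (K × E₂ × K)) : ℕ :=
  Nat.card {w : K × (E₁ × E₂) // ∃ h ∈ H, Algebra.trace (ZMod p) K (encode Q h w.2 * w.1) ≠ 0}

/-- The map from parameters to words of the descended code. -/
noncomputable def wordMap (Q : QuadraticForm K E₁) (L : ℕ) (θ : K) :
    (K × E₂ × K) →ₗ[ZMod p] (Fin L × (E₁ × E₂) → ZMod p) :=
  descendWord p L θ ∘ₗ (encode Q).restrictScalars (ZMod p)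

theorem descend_codeQ' (Q : QuadraticForm K E₁) (L : ℕ) (θ : K) :
    descend p L θ (codeQ' E₂ Q) = LinearMap.range (wordMap (p := p) (E₂ := E₂) Q L θ) := by
  rw [wordMap, LinearMap.range_comp, LinearMap.range_restrictScalars]
  rfl

variable [Finite E₁]

/-- For fixed `z`, the number of positions seen by `H` does not change when `z` is scaled by
`F_p^*`, so the sum over powers of `θ` becomes a sum over `Kˣ`; `z = 0` contributes nothing. -/
theorem mul_ncard_supp_map [DecidableEq K] (Q : QuadraticForm K E₁)
    {N : ℕ} (hN : N ∣ p - 1) (hN' : Nat.Coprime N ((Fintype.card K - 1) / (p - 1)))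
    {θ : K} (hθ : IsPrimitiveRoot θ ((Fintype.card K - 1) / N))
    (H : Submodule (ZMod p) (K × E₂ × K)) :
    N * (supp (H.map (wordMap Q ((Fintype.card K - 1) / N) θ))).ncard = traceSupp Q H := by
  set l := (Fintype.card K - 1) / N
  let f : K → ℕ := fun z =>
    Nat.card {w : E₁ × E₂ // ∃ h ∈ H, Algebra.trace (ZMod p) K (encode Q h w * z) ≠ 0}
  have h1 : (supp (H.map (wordMap Q l θ))).ncard = ∑ i : Fin l, f (θ ^ (i : ℕ)) := by
    rw [← natCard_subtype_prod fun (i : Fin l) (w : E₁ × E₂) =>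
      ∃ h ∈ H, Algebra.trace (ZMod p) K (encode Q h w * θ ^ (i : ℕ)) ≠ 0]
    refine Nat.card_congr (Equiv.subtypeEquivRight fun w => ?_)
    constructor
    · rintro ⟨_, ⟨h, hh, rfl⟩, hc⟩
      exact ⟨h, hh, hc⟩
    · rintro ⟨h, hh, hc⟩
      exact ⟨_, ⟨h, hh, rfl⟩, hc⟩
  have h2 : ∀ (c : ZMod p) (z : K), c ≠ 0 → f (c • z) = f z := by
    intro c z hc
    refine Nat.card_congr (Equiv.subtypeEquivRight fun w => ?_)
    simp only [mul_smul_comm, map_smul, smul_eq_mul, mul_ne_zero_iff, ne_eq, hc, not_false_eq_true,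
      true_and]
  have h3 : f 0 = 0 := by
    have : IsEmpty {w : E₁ × E₂ // ∃ h ∈ H, Algebra.trace (ZMod p) K (encode Q h w * 0) ≠ 0} :=
      ⟨by rintro ⟨w, h, -, h0⟩; simp at h0⟩
    exact Nat.card_of_isEmpty
  rw [h1, mul_sum_pow_eq_sum_units hN hN' hθ f h2, traceSupp, natCard_subtype_prod fun z w =>
    ∃ h ∈ H, Algebra.trace (ZMod p) K (encode Q h w * z) ≠ 0]
  change _ = ∑ z, f z
  rw [← Finset.sum_erase (a := 0) _ h3]
  refine Finset.sum_bij (fun z _ => (z : K)) (by simp) (fun _ _ _ _ => Units.ext)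
    (fun z hz => ⟨Units.mk0 z (Finset.ne_of_mem_erase hz), by simp⟩) (fun _ _ => rfl)

/-- Position by position, this is the duality count for the evaluation map `H → K` and the trace
form, followed by an exchange of summations. -/
theorem natCard_mul_traceSupp (Q : QuadraticForm K E₁) (H : Submodule (ZMod p) (K × E₂ × K)) :
    Nat.card H * traceSupp Q H =
      Nat.card K * ∑ᶠ h : H, Nat.card {w : E₁ × E₂ // encode Q h.1 w ≠ 0} := by
  have := Fintype.ofFinite E₁
  have := Fintype.ofFinite E₂
  have := Fintype.ofFinite H
  rw [finsum_eq_sum_of_fintype, ← natCard_subtype_prod fun (h : H) w => encode Q h.1 w ≠ 0,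
    natCard_subtype_prod' fun (h : H) w => encode Q h.1 w ≠ 0, traceSupp,
    natCard_subtype_prod' fun z w => ∃ h ∈ H, Algebra.trace (ZMod p) K (encode Q h w * z) ≠ 0,
    Finset.mul_sum, Finset.mul_sum]
  refine Finset.sum_congr rfl fun w _ => ?_
  let l : H →ₗ[ZMod p] K :=
    LinearMap.proj w ∘ₗ (encode Q).restrictScalars (ZMod p) ∘ₗ H.subtype
  refine Eq.trans ?_ (natCard_mul_natCard_not_orthogonal (traceForm_nondegenerate (ZMod p) K) l)
  congr 1
  refine Nat.card_congr (Equiv.subtypeEquivRight fun z => ?_)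
  exact ⟨fun ⟨h, hh, h0⟩ => ⟨⟨h, hh⟩, h0⟩, fun ⟨h, h0⟩ => ⟨h.1, h.2, h0⟩⟩

/-- The number of zeros of a nonzero word. -/
theorem natCard_encode_eq_zero_le (Q : QuadraticForm K E₁) {n : ℕ}
    (hn : ∀ t, Nat.card {x // Q x = t} ≤ n) (hn' : Nat.card E₁ ≤ Nat.card K * n)
    {h : K × E₂ × K} (hh : h ≠ 0) :
    Nat.card {w : E₁ × E₂ // encode Q h w = 0} ≤ Nat.card E₂ * n := by
  have := Fintype.ofFinite E₁
  have := Fintype.ofFinite E₂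
  obtain ⟨a, b, c⟩ := h
  simp only [encode_apply]
  by_cases hb : b = 0
  -- The zeros are constrained in `x` only: for each `y` they form a fibre of `Q`, or nothing when
  -- `a = 0`, since then `c ≠ 0`.
  · subst hb
    rw [natCard_subtype_prod' fun (x : E₁) (y : E₂) =>
      a * Q x + Algebra.trace K E₂ (0 * y) + c = 0]
    refine (Finset.sum_le_card_nsmul _ _ n fun y _ => ?_).trans_eq (by simp)
    by_cases ha : a = 0
    · subst ha
      have hc : c ≠ 0 := by rintro rfl; exact hh rfl
      simp [hc]
    · refine le_trans (le_of_eq ?_) (hn (-c / a))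
      refine Nat.card_congr (Equiv.subtypeEquivRight fun x => ?_)
      rw [zero_mul, map_zero, add_zero, eq_div_iff ha, mul_comm, eq_neg_iff_add_eq_zero]
  · rw [natCard_subtype_prod fun (x : E₁) (y : E₂) =>
      a * Q x + Algebra.trace K E₂ (b * y) + c = 0]
    -- For `b ≠ 0` the trace term is onto `K`, so each `x` has at most `|E₂| / q` zeros above it,
    -- and `|E₁| ≤ q * n` bounds the total.
    let g : E₂ →ₗ[K] K := Algebra.trace K E₂ ∘ₗ LinearMap.mulLeft K b
    have hg : Function.Surjective g := by
      intro t
      obtain ⟨y, hy⟩ := Algebra.trace_surjective K E₂ t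
      exact ⟨b⁻¹ * y, by simp [g, hb, hy]⟩
    have hker := natCard_range_mul_natCard_ker g
    rw [LinearMap.range_eq_top.2 hg, Nat.card_congr Submodule.topEquiv.toEquiv] at hker
    have hle : ∀ x : E₁, Nat.card {y : E₂ // a * Q x + Algebra.trace K E₂ (b * y) + c = 0} ≤
        Nat.card (LinearMap.ker g) := by
      intro x
      obtain ⟨y₀, hy₀⟩ := hg (-(a * Q x + c))
      refine Nat.card_le_card_of_injective
        (fun y => ⟨y.1 - y₀, ?_⟩) fun y y' hy => ?_
      · have h1 : a * Q x + g y.1 + c = 0 := y.2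
        rw [LinearMap.mem_ker, map_sub, hy₀]
        linear_combination h1
      · simpa [Subtype.ext_iff] using hy
    refine (Finset.sum_le_card_nsmul _ _ _ fun x _ => hle x).trans ?_
    rw [Finset.card_univ, smul_eq_mul, ← Nat.card_eq_fintype_card, ← hker]
    calc _ ≤ Nat.card K * n * Nat.card (LinearMap.ker g) := Nat.mul_le_mul_right _ hn'
      _ = _ := by ring

/-- These are the words `a * (Q x - t)`, which attain the zero bound when the fibre over `t` is
largest. -/
theorem natCard_encode_eq_zero (Q : QuadraticForm K E₁) {a t : K} (ha : a ≠ 0) :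
    Nat.card {w : E₁ × E₂ // encode Q (a, 0, -(a * t)) w = 0} =
      Nat.card E₂ * Nat.card {x // Q x = t} := by
  rw [mul_comm (Nat.card E₂), ← Nat.card_prod]
  refine Nat.card_congr (.trans (Equiv.subtypeEquivRight fun w => ?_)
    (Equiv.prodSubtypeFstEquivSubtypeProd (β := E₂) (p := fun x : E₁ => Q x = t)))
  rw [encode_apply, zero_mul, map_zero, add_zero, ← sub_eq_add_neg, sub_eq_zero]
  exact ⟨fun h => mul_left_cancel₀ ha h, fun h => by rw [h]⟩

theorem natCard_encode_ne_zero_add (Q : QuadraticForm K E₁) (h : K × E₂ × K) :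
    Nat.card {w : E₁ × E₂ // encode Q h w ≠ 0} + Nat.card {w : E₁ × E₂ // encode Q h w = 0} =
      Nat.card E₁ * Nat.card E₂ := by
  rw [← Nat.card_prod, ← natCard_not_mem_add {w : E₁ × E₂ | encode Q h w = 0}]
  rfl

/-- Each of the `|H| - 1` nonzero parameters contributes at least the minimum weight to the primal
count. -/
theorem le_natCard_mul_traceSupp (Q : QuadraticForm K E₁) {n : ℕ}
    (hn : ∀ t, Nat.card {x // Q x = t} ≤ n) (hn' : Nat.card E₁ ≤ Nat.card K * n)
    (H : Submodule (ZMod p) (K × E₂ × K)) :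
    (Nat.card K : ℤ) * ((Nat.card H - 1) * (Nat.card E₁ * Nat.card E₂ - Nat.card E₂ * n)) ≤
      Nat.card H * traceSupp Q H := by
  classical
  have := Fintype.ofFinite H
  have h := natCard_mul_traceSupp Q H
  rw [finsum_eq_sum_of_fintype] at h
  rw [← Nat.cast_mul (Nat.card H), h, Nat.cast_mul]
  refine mul_le_mul_of_nonneg_left ?_ (Nat.cast_nonneg _)
  rw [Nat.cast_sum, ← Finset.sum_erase_add _ _ (Finset.mem_univ (0 : H))]
  refine le_add_of_le_of_nonneg ?_ (Nat.cast_nonneg _)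
  have hc : (Nat.card H : ℤ) - 1 = (Finset.univ.erase (0 : H)).card := by
    rw [Finset.card_erase_of_mem (Finset.mem_univ _), Finset.card_univ,
      Nat.cast_sub Fintype.card_pos, Nat.card_eq_fintype_card, Nat.cast_one]
  rw [hc, ← nsmul_eq_mul]
  refine Finset.card_nsmul_le_sum _ _ _ fun x hx => ?_
  have hx0 : x.1 ≠ 0 := fun h0 => Finset.ne_of_mem_erase hx (Subtype.ext h0)
  have h1 := natCard_encode_eq_zero_le Q hn hn' hx0
  have h2 := natCard_encode_ne_zero_add Q x.1
  zify at h1 h2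
  linarith

theorem natCard_mul_traceSupp_eq (Q : QuadraticForm K E₁) {n : ℕ}
    (H : Submodule (ZMod p) (K × E₂ × K))
    (hH : ∀ h ∈ H, h ≠ 0 → Nat.card {w : E₁ × E₂ // encode Q h w = 0} = Nat.card E₂ * n) :
    Nat.card H * (traceSupp Q H : ℤ) =
      (Nat.card K : ℤ) * ((Nat.card H - 1) * (Nat.card E₁ * Nat.card E₂ - Nat.card E₂ * n)) := by
  classical
  have := Fintype.ofFinite H
  have h := natCard_mul_traceSupp Q H
  rw [finsum_eq_sum_of_fintype] at h
  rw [← Nat.cast_mul (Nat.card H), h, Nat.cast_mul]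
  congr 1
  have h0 : Nat.card {w : E₁ × E₂ // encode Q ((0 : H) : K × E₂ × K) w ≠ 0} = 0 := by simp
  rw [Nat.cast_sum, ← Finset.sum_erase_add _ _ (Finset.mem_univ (0 : H)), h0, Nat.cast_zero,
    add_zero]
  have hc : (Nat.card H : ℤ) - 1 = (Finset.univ.erase (0 : H)).card := by
    rw [Finset.card_erase_of_mem (Finset.mem_univ _), Finset.card_univ,
      Nat.cast_sub Fintype.card_pos, Nat.card_eq_fintype_card, Nat.cast_one]
  rw [hc, ← nsmul_eq_mul]
  refine Finset.sum_eq_card_nsmul fun x hx => ?_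
  have hx0 : x.1 ≠ 0 := fun h0 => Finset.ne_of_mem_erase hx (Subtype.ext h0)
  have h1 := hH x.1 x.2 hx0
  have h2 := natCard_encode_ne_zero_add Q x.1
  zify at h1 h2
  linarith

/-- The positions outside the support, counted through the orthogonal complement of `H`. -/
theorem traceSupp_add_sum (Q : QuadraticForm K E₁) (H : Submodule (ZMod p) (K × E₂ × K)) :
    traceSupp Q H + ∑ᶠ v : {v : K × E₂ × K // v ∈ (pairing p K E₂).orthogonal H ∧ v.2.2 ≠ 0},
      Nat.card {x // Q x = v.1.1 / v.1.2.2} + Nat.card E₁ * Nat.card E₂ =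
      Nat.card K * (Nat.card E₁ * Nat.card E₂) := by
  have := Fintype.ofFinite
    {v : K × E₂ × K // v ∈ (pairing p K E₂).orthogonal H ∧ v.2.2 ≠ 0}
  let s : Set (K × (E₁ × E₂)) :=
    {w | ∃ h ∈ H, Algebra.trace (ZMod p) K (encode Q h w.2 * w.1) ≠ 0}
  have hmem : ∀ w : K × (E₁ × E₂), w ∉ s ↔
      (w.1 * Q w.2.1, w.1 • w.2.2, w.1) ∈ (pairing p K E₂).orthogonal H := by
    intro w
    simp only [s, Set.mem_ofPred_eq, trace_encode_mul, LinearMap.BilinForm.mem_orthogonal_iff,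
      not_exists, not_and, not_not]
  -- The triples with `z = 0` are all outside the support and are split off.
  have e1 : Nat.card {w : K × (E₁ × E₂) // w ∉ s} =
      Nat.card {w : {w : K × (E₁ × E₂) // w ∉ s} // w.1.1 ≠ 0} + Nat.card E₁ * Nat.card E₂ := by
    rw [← natCard_not_mem_add {w : {w : K × (E₁ × E₂) // w ∉ s} | w.1.1 = 0}, ← Nat.card_prod]
    congr 1
    refine Nat.card_congr ⟨fun w => w.1.1.2, fun x => ⟨⟨(0, x), ?_⟩, rfl⟩, ?_, fun _ => rfl⟩
    · simp [s]
    · rintro ⟨⟨⟨z, x⟩, hw⟩, rfl : z = 0⟩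
      rfl
  -- For `γ ≠ 0`, a preimage of `(α, β, γ)` has `z = γ` and `y = γ⁻¹ • β` forced, and `x` is free in
  -- the fibre over `α / γ`.
  have e2 : Nat.card {w : {w : K × (E₁ × E₂) // w ∉ s} // w.1.1 ≠ 0} =
      ∑ v : {v : K × E₂ × K // v ∈ (pairing p K E₂).orthogonal H ∧ v.2.2 ≠ 0},
      Nat.card {x // Q x = v.1.1 / v.1.2.2} := by
    rw [← Nat.card_sigma]
    refine Nat.card_congr ⟨
      fun w => ⟨⟨(w.1.1.1 * Q w.1.1.2.1, w.1.1.1 • w.1.1.2.2, w.1.1.1), (hmem _).1 w.1.2, w.2⟩,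
        w.1.1.2.1, (mul_div_cancel_left₀ _ w.2).symm⟩,
      fun v => ⟨⟨(v.1.1.2.2, v.2.1, v.1.1.2.2⁻¹ • v.1.1.2.1), ?_⟩, v.1.2.2⟩, ?_, ?_⟩
    · rw [hmem]
      obtain ⟨⟨⟨α, β, γ⟩, hv, hγ⟩, x, hx⟩ := v
      change γ ≠ 0 at hγ
      simp only at hx ⊢
      rwa [hx, mul_div_cancel₀ _ hγ, smul_inv_smul₀ hγ]
    · rintro ⟨⟨⟨z, x, y⟩, hw⟩, hz⟩
      change z ≠ 0 at hz
      simp [inv_smul_smul₀ hz]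
    · rintro ⟨⟨⟨α, β, γ⟩, hv, hγ⟩, x, hx⟩
      change γ ≠ 0 at hγ
      have hx' : Q x = α / γ := hx
      have hα : γ * Q x = α := by rw [hx', mul_div_cancel₀ _ hγ]
      subst hα
      simp [smul_inv_smul₀ hγ]
  have e3 : traceSupp Q H = Nat.card s := rfl
  rw [finsum_eq_sum_of_fintype, ← e2, add_assoc, ← e1, e3, add_comm, natCard_not_mem_add,
    Nat.card_prod, Nat.card_prod]

end Code

theorem finrank_map_of_injective {F V W : Type*} [Field F] [AddCommGroup V] [Module F V]
    [AddCommGroup W] [Module F W] {f : V →ₗ[F] W} (hf : Function.Injective f)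
    (U : Submodule F V) : Module.finrank F (U.map f) = Module.finrank F U :=
  (Submodule.equivMapOfInjective f hf U).finrank_eq.symm

/-! ### Bounds from the dual count, extremal subspaces, and reduction of the weights to `traceSupp`.
-/

section Weights

variable {p : ℕ} [Fact p.Prime] {K E₁ E₂ : Type*} [Field K] [Fintype K] [Algebra (ZMod p) K]
  [Field E₁] [Algebra K E₁] [Field E₂] [Algebra K E₂] [Algebra (ZMod p) E₂]
  [IsScalarTower (ZMod p) K E₂] [Finite E₁] [Finite E₂]

theorem natCard_submodule {V : Type*} [AddCommGroup V] [Module (ZMod p) V] [Finite V]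
    (H : Submodule (ZMod p) V) : Nat.card H = p ^ Module.finrank (ZMod p) H := by
  rw [Module.natCard_eq_pow_finrank (K := ZMod p), Nat.card_zmod]

/-- The vectors of `P` with last coordinate `0` form the kernel of a map to `K`, with at least `1`
and at least `|P| / q` elements. The first bound serves the range `r > m * (m₂ + 1)`, the second the
middle range. -/
theorem natCard_last_ne_zero (P : Submodule (ZMod p) (K × E₂ × K)) :
    Nat.card {v : K × E₂ × K // v ∈ P ∧ v.2.2 ≠ 0} + 1 ≤ Nat.card P ∧
      Nat.card K * Nat.card {v : K × E₂ × K // v ∈ P ∧ v.2.2 ≠ 0} + Nat.card P ≤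
        Nat.card K * Nat.card P := by
  let g : P →ₗ[ZMod p] K := (LinearMap.snd _ _ _ ∘ₗ LinearMap.snd _ _ _) ∘ₗ P.subtype
  have h1 : Nat.card {v : K × E₂ × K // v ∈ P ∧ v.2.2 ≠ 0} + Nat.card (LinearMap.ker g) =
      Nat.card P := by
    rw [← natCard_not_mem_add (LinearMap.ker g : Set P)]
    congr 1
    exact Nat.card_congr (Equiv.subtypeSubtypeEquivSubtypeInter (· ∈ P)
      (fun v : K × E₂ × K => v.2.2 ≠ 0)).symm
  have h2 := natCard_range_mul_natCard_ker g
  have h3 : Nat.card (LinearMap.range g) ≤ Nat.card K :=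
    Nat.card_le_card_of_injective _ Subtype.val_injective
  have h4 : 0 < Nat.card (LinearMap.ker g) := Nat.card_pos
  have h5 := Nat.mul_le_mul_right (Nat.card (LinearMap.ker g)) h3
  constructor
  · omega
  · rw [← h1] at h2 ⊢
    nlinarith

theorem le_traceSupp_add (Q : QuadraticForm K E₁) {n : ℕ}
    (hn : ∀ t, Nat.card {x // Q x = t} ≤ n) (H : Submodule (ZMod p) (K × E₂ × K)) :
    Nat.card K * (Nat.card E₁ * Nat.card E₂) ≤ traceSupp Q H +
      Nat.card {v : K × E₂ × K // v ∈ (pairing p K E₂).orthogonal H ∧ v.2.2 ≠ 0} * n +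
        Nat.card E₁ * Nat.card E₂ := by
  have := Fintype.ofFinite
    {v : K × E₂ × K // v ∈ (pairing p K E₂).orthogonal H ∧ v.2.2 ≠ 0}
  rw [← traceSupp_add_sum Q H, finsum_eq_sum_of_fintype]
  gcongr
  refine (Finset.sum_le_card_nsmul _ _ n fun v _ => hn _).trans_eq ?_
  rw [Finset.card_univ, smul_eq_mul, Nat.card_eq_fintype_card]

/-- Under `hH` every ratio `α / γ` equals `t`, so all fibres in the dual count coincide. -/
theorem traceSupp_add_eq (Q : QuadraticForm K E₁) (t : K) {H : Submodule (ZMod p) (K × E₂ × K)}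
    (hH : ∀ v ∈ (pairing p K E₂).orthogonal H, v.1 = t * v.2.2) :
    traceSupp Q H +
      Nat.card {v : K × E₂ × K // v ∈ (pairing p K E₂).orthogonal H ∧ v.2.2 ≠ 0} *
        Nat.card {x // Q x = t} + Nat.card E₁ * Nat.card E₂ =
      Nat.card K * (Nat.card E₁ * Nat.card E₂) := by
  have := Fintype.ofFinite
    {v : K × E₂ × K // v ∈ (pairing p K E₂).orthogonal H ∧ v.2.2 ≠ 0}
  rw [← traceSupp_add_sum Q H, finsum_eq_sum_of_fintype]
  congr 2
  rw [Nat.card_eq_fintype_card, ← smul_eq_mul, ← Finset.card_univ]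
  refine (Finset.sum_eq_card_nsmul fun v _ => ?_).symm
  rw [hH v.1 v.2.1, mul_div_cancel_right₀ _ v.2.2]

/-- For subspaces `B` of `E₂` and `G` of `K` there is a subspace of parameters whose orthogonal
complement is `{(t γ, β, γ) : β ∈ B, γ ∈ G}`. -/
theorem exists_orthogonal_eq (t : K) (B : Submodule (ZMod p) E₂) (G : Submodule (ZMod p) K) :
    ∃ H : Submodule (ZMod p) (K × E₂ × K),
      Module.finrank (ZMod p) H + (Module.finrank (ZMod p) B + Module.finrank (ZMod p) G) =
        Module.finrank (ZMod p) (K × E₂ × K) ∧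
      (∀ v ∈ (pairing p K E₂).orthogonal H, v.1 = t * v.2.2) ∧
      Nat.card {v : K × E₂ × K // v ∈ (pairing p K E₂).orthogonal H ∧ v.2.2 ≠ 0} =
        Nat.card B * (Nat.card G - 1) := by
  classical
  let j : (E₂ × K) →ₗ[ZMod p] (K × E₂ × K) :=
    (LinearMap.mulLeft (ZMod p) t ∘ₗ LinearMap.snd _ _ _).prod LinearMap.id
  have hj : ∀ w, j w = (t * w.2, w) := fun w => rfl
  have hinj : Function.Injective j := fun w w' h => by simpa [hj] using (Prod.ext_iff.1 h).2
  let P : Submodule (ZMod p) (K × E₂ × K) := (B.prod G).map j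
  have hP : (pairing p K E₂).orthogonal ((pairing p K E₂).orthogonal P) = P :=
    LinearMap.BilinForm.orthogonal_orthogonal pairing_nondegenerate pairing_isRefl P
  have hPr : Module.finrank (ZMod p) P =
      Module.finrank (ZMod p) B + Module.finrank (ZMod p) G := by
    have hr : B.prod G = LinearMap.range (B.subtype.prodMap G.subtype) := by
      rw [LinearMap.range_prodMap, Submodule.range_subtype, Submodule.range_subtype]
    rw [finrank_map_of_injective hinj, hr, LinearMap.finrank_range_of_inj
      (Prod.map_injective.2 ⟨Subtype.val_injective, Subtype.val_injective⟩), Module.finrank_prod]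
  -- Taking `H = P^⊥` suffices, since `P^⊥⊥ = P` for this nondegenerate reflexive pairing.
  refine ⟨(pairing p K E₂).orthogonal P, ?_, ?_, ?_⟩
  · rw [LinearMap.BilinForm.finrank_orthogonal pairing_nondegenerate, ← hPr,
      Nat.sub_add_cancel (Submodule.finrank_le P)]
  · rw [hP]
    rintro _ ⟨w, -, rfl⟩
    rfl
  · rw [hP]
    have : Nat.card G - 1 = Nat.card {γ : G // γ ≠ 0} := by
      rw [← natCard_not_mem_add ({0} : Set G)]
      simp
    rw [this, ← Nat.card_prod]
    symm
    refine Nat.card_congr ⟨fun w => ⟨j (w.1, w.2.1), ⟨_, ⟨w.1.2, w.2.1.2⟩, rfl⟩,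
      fun h => w.2.2 (Subtype.ext h)⟩, fun v => (⟨v.1.2.1, ?_⟩, ⟨⟨v.1.2.2, ?_⟩, ?_⟩), ?_, ?_⟩
    · obtain ⟨_, ⟨w, hw, rfl⟩, -⟩ := v
      exact hw.1
    · obtain ⟨_, ⟨w, hw, rfl⟩, -⟩ := v
      exact hw.2
    · exact fun h => v.2.2 (congrArg Subtype.val h)
    · intro w; rfl
    · rintro ⟨_, ⟨w, hw, rfl⟩, h⟩
      rfl

variable [DecidableEq K]

section

variable (Q : QuadraticForm K E₁) {N : ℕ} (hN : N ∣ p - 1)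
  (hN' : Nat.Coprime N ((Fintype.card K - 1) / (p - 1)))
  {θ : K} (hθ : IsPrimitiveRoot θ ((Fintype.card K - 1) / N))

include hN hN' hθ

/-- A nonzero `h` in the kernel would span a line with empty support, whereas the primal bound with
`|H| = p` is positive because `n < |E₁|`. -/
theorem wordMap_injective {n : ℕ} (hn : ∀ t, Nat.card {x // Q x = t} ≤ n)
    (hn' : Nat.card E₁ ≤ Nat.card K * n) (hlt : n < Nat.card E₁) :
    Function.Injective (wordMap (p := p) (E₂ := E₂) Q ((Fintype.card K - 1) / N) θ) := by
  rw [← LinearMap.ker_eq_bot, LinearMap.ker_eq_bot']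
  intro h hh
  by_contra h0
  let H : Submodule (ZMod p) (K × E₂ × K) := Submodule.span (ZMod p) {h}
  have h1 := mul_ncard_supp_map Q hN hN' hθ H
  have h2 : H.map (wordMap Q ((Fintype.card K - 1) / N) θ) = ⊥ := by
    rw [Submodule.map_span, Set.image_singleton, hh, Submodule.span_zero_singleton]
  have h3 : supp (⊥ : Submodule (ZMod p) (Fin ((Fintype.card K - 1) / N) × (E₁ × E₂) → ZMod p)) =
      ∅ := by
    ext i
    simp [supp]
  rw [h2, h3, Set.ncard_empty, mul_zero] at h1
  have h4 := le_natCard_mul_traceSupp Q hn hn' H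
  rw [← h1, natCard_submodule, finrank_span_singleton h0, pow_one, Nat.cast_zero, mul_zero] at h4
  have hp : (1 : ℤ) < p := by exact_mod_cast (Fact.out : p.Prime).one_lt
  have hK : (0 : ℤ) < Nat.card K := by exact_mod_cast Nat.card_pos
  have hE : (0 : ℤ) < Nat.card E₂ := by exact_mod_cast Nat.card_pos
  have hlt' : (n : ℤ) < Nat.card E₁ := by exact_mod_cast hlt
  have : 0 < (Nat.card K : ℤ) * ((p - 1) * (Nat.card E₂ * (Nat.card E₁ - n))) := by
    have h5 := sub_pos.2 hp
    have h6 := sub_pos.2 hlt'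
    positivity
  linarith

/-- By injectivity every subcode is the image of a parameter space of the same dimension, so
minimizing `traceSupp` minimizes the support. -/
theorem mul_ghw_eq
    (hinj : Function.Injective (wordMap (p := p) (E₂ := E₂) Q ((Fintype.card K - 1) / N) θ))
    (H₀ : Submodule (ZMod p) (K × E₂ × K))
    (hmin : ∀ H : Submodule (ZMod p) (K × E₂ × K),
      Module.finrank (ZMod p) H = Module.finrank (ZMod p) H₀ → traceSupp Q H₀ ≤ traceSupp Q H) :
    N * ghw (descend p ((Fintype.card K - 1) / N) θ (codeQ' E₂ Q))
      (Module.finrank (ZMod p) H₀) = traceSupp Q H₀ := by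
  have hp := (Fact.out : p.Prime).one_lt
  have hN0 : 0 < N := Nat.pos_of_dvd_of_pos hN (by omega)
  set Φ := wordMap (p := p) (E₂ := E₂) Q ((Fintype.card K - 1) / N) θ with hΦ
  have h0 : IsLeast {n | ∃ D : Submodule (ZMod p) (Fin ((Fintype.card K - 1) / N) × (E₁ × E₂) →
      ZMod p), D ≤ LinearMap.range Φ ∧ Module.finrank (ZMod p) D = Module.finrank (ZMod p) H₀ ∧
        (supp D).ncard = n} (supp (H₀.map Φ)).ncard := by
    constructor
    · exact ⟨_, LinearMap.map_le_range, finrank_map_of_injective hinj _, rfl⟩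
    · rintro _ ⟨D, hD, hr, rfl⟩
      rw [← Submodule.map_comap_eq_of_le hD] at hr ⊢
      rw [finrank_map_of_injective hinj] at hr
      have h1 := hmin _ hr
      rw [← mul_ncard_supp_map Q hN hN' hθ, ← mul_ncard_supp_map Q hN hN' hθ] at h1
      exact Nat.le_of_mul_le_mul_left h1 hN0
  rw [descend_codeQ', ghw, h0.csInf_eq, mul_ncard_supp_map Q hN hN' hθ]

end

end Weights

/-! ### The three ranges of `r`. -/

section Hierarchy

variable {p : ℕ} [Fact p.Prime] {K E₁ E₂ : Type*} [Field K] [Fintype K] [DecidableEq K]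
  [Algebra (ZMod p) K] [Field E₁] [Algebra K E₁] [Field E₂] [Algebra K E₂]

theorem finrank_eq_of_card {m : ℕ} (hK : Fintype.card K = p ^ m) :
    Module.finrank (ZMod p) K = m := by
  rw [← Nat.card_eq_fintype_card, Module.natCard_eq_pow_finrank (K := ZMod p), Nat.card_zmod] at hK
  exact Nat.pow_right_injective (Fact.out : p.Prime).two_le hK

/-- The weight hierarchy of the descended code, in terms of the largest number
`q ^ (m₁ - 1) * (1 + ω)` of representations of an element of `K` by `Q`. -/
theorem weight_hierarchy {m m₁ m₂ N : ℕ} (hK : Fintype.card K = p ^ m)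
    (hE₁ : Nat.card E₁ = Fintype.card K ^ m₁) (hE₂ : Module.finrank K E₂ = m₂) (hm₂ : 0 < m₂)
    (hN : N ∣ p - 1) (hN' : Nat.Coprime N ((Fintype.card K - 1) / (p - 1)))
    {θ : K} (hθ : IsPrimitiveRoot θ ((Fintype.card K - 1) / N)) (Q : QuadraticForm K E₁)
    {q ω : ℝ} (hq : q = Fintype.card K) (hω : 0 ≤ ω) (hω' : ω < q - 1) (t₀ : K)
    (hmax : ∀ t, Nat.card {x // Q x = t} ≤ Nat.card {x // Q x = t₀})
    (ht₀ : (Nat.card {x // Q x = t₀} : ℝ) * q = q ^ m₁ * (1 + ω)) :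
    Module.finrank (ZMod p) (descend p ((Fintype.card K - 1) / N) θ (codeQ' E₂ Q)) =
      m * (m₂ + 2) ∧ ∀ r ≤ m * (m₂ + 2),
        (r ≤ m → (ghw (descend p ((Fintype.card K - 1) / N) θ (codeQ' E₂ Q)) r : ℝ) =
          q ^ (m₁ + m₂) / (p ^ r * N) * ((p ^ r - 1) * (q - 1 - ω))) ∧
        (m < r → r ≤ m * (m₂ + 1) →
          (ghw (descend p ((Fintype.card K - 1) / N) θ (codeQ' E₂ Q)) r : ℝ) =
            q ^ (m₁ + m₂) * (q - 1) / (p ^ r * N) * (p ^ r - 1 - ω)) ∧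
        (m * (m₂ + 1) < r →
          (ghw (descend p ((Fintype.card K - 1) / N) θ (codeQ' E₂ Q)) r : ℝ) =
            q ^ (m₁ + m₂) / (p ^ r * N) *
              (p ^ r * (q - 1) - (q - p ^ (r - m * (m₂ + 1))) * (1 + ω))) := by
  -- The `F_p`-structure on `E₂` is taken through `K` to obtain the scalar tower; the statement does
  -- not mention it.
  let _ : Algebra (ZMod p) E₂ := ((algebraMap K E₂).comp (algebraMap (ZMod p) K)).toAlgebra
  have : IsScalarTower (ZMod p) K E₂ := IsScalarTower.of_algebraMap_eq fun _ => rfl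
  have hp := (Fact.out : p.Prime).one_lt
  have hq1 : 1 < Fintype.card K := Fintype.one_lt_card
  have hqr : 1 < q := by rw [hq]; exact_mod_cast hq1
  have hq0 : 0 < q := by linarith
  have hN0 : 0 < N := Nat.pos_of_dvd_of_pos hN (by omega)
  have : FiniteDimensional K E₂ := FiniteDimensional.of_finrank_pos (by omega)
  have : Finite E₂ := Module.finite_of_finite K
  have : Finite E₁ := Nat.finite_of_card_ne_zero (by rw [hE₁]; positivity)
  have hcE₂ : Nat.card E₂ = Fintype.card K ^ m₂ := by
    rw [Module.natCard_eq_pow_finrank (K := K), hE₂, Nat.card_eq_fintype_card]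
  set n := Nat.card {x // Q x = t₀} with hn
  have rE₁ : (Nat.card E₁ : ℝ) = q ^ m₁ := by rw [hE₁, hq]; push_cast; rfl
  have rE₂ : (Nat.card E₂ : ℝ) = q ^ m₂ := by rw [hcE₂, hq]; push_cast; rfl
  have rK : (Nat.card K : ℝ) = q := by rw [hq, Nat.card_eq_fintype_card]
  have rK' : q = (p : ℝ) ^ m := by rw [hq, hK]; push_cast; rfl
  have hn' : Nat.card E₁ ≤ Nat.card K * n := by
    have : (Nat.card E₁ : ℝ) ≤ Nat.card K * n := by
      rw [rE₁, rK, mul_comm, ht₀]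
      exact le_mul_of_one_le_right (by positivity) (by linarith)
    exact_mod_cast this
  have hlt : n < Nat.card E₁ := by
    have : (n : ℝ) < Nat.card E₁ := by
      rw [rE₁]
      refine lt_of_mul_lt_mul_right ?_ hq0.le
      rw [ht₀]
      exact mul_lt_mul_of_pos_left (by linarith) (by positivity)
    exact_mod_cast this
  have hinj := wordMap_injective (E₂ := E₂) Q hN hN' hθ hmax hn' hlt
  have fK := finrank_eq_of_card hK
  have fE₂ : Module.finrank (ZMod p) E₂ = m * m₂ := by
    rw [← Module.finrank_mul_finrank (ZMod p) K E₂, fK, hE₂]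
  have fV : Module.finrank (ZMod p) (K × E₂ × K) = m * (m₂ + 2) := by
    rw [Module.finrank_prod, Module.finrank_prod, fK, fE₂]; ring
  have fP : ∀ H : Submodule (ZMod p) (K × E₂ × K),
      Module.finrank (ZMod p) ((pairing p K E₂).orthogonal H) =
        m * (m₂ + 2) - Module.finrank (ZMod p) H := fun H => by
    rw [LinearMap.BilinForm.finrank_orthogonal pairing_nondegenerate, fV]
  have hpN : ∀ r : ℕ, (0 : ℝ) < p ^ r * N := fun r => by
    have : (0 : ℝ) < p := by exact_mod_cast (by omega : 0 < p)
    positivity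
  have hp0 : ∀ r : ℕ, (0 : ℝ) < p ^ r := fun r => by
    have : (0 : ℝ) < p := by exact_mod_cast (by omega : 0 < p)
    positivity
  refine ⟨?_, fun r hr => ⟨fun hrm => ?_, fun hmr hrm => ?_, fun hmr => ?_⟩⟩
  · rw [descend_codeQ', LinearMap.finrank_range_of_inj hinj, fV]
  -- Range `r ≤ m`: the words `a * (Q x - t₀)` with `a` in an `r`-dimensional `A ≤ K` attain the
  -- primal bound.
  · obtain ⟨A, hA⟩ := exists_submodule_finrank_eq (F := ZMod p) (V := K) (n := r) (by omega)
    let j : K →ₗ[ZMod p] (K × E₂ × K) :=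
      LinearMap.id.prod ((0 : K →ₗ[ZMod p] E₂).prod (-LinearMap.mulRight (ZMod p) t₀))
    have hj : ∀ a, j a = (a, 0, -(a * t₀)) := fun a => rfl
    have hjinj : Function.Injective j := fun a b h => (Prod.ext_iff.1 h).1
    have h0 : Module.finrank (ZMod p) (A.map j) = r := by
      rw [finrank_map_of_injective hjinj, hA]
    have hS := natCard_mul_traceSupp_eq Q (n := n) (A.map j) (by
      rintro _ ⟨a, -, rfl⟩ ha
      exact natCard_encode_eq_zero Q (by rintro rfl; exact ha (map_zero j)))
    rw [natCard_submodule, h0] at hS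
    have hg := mul_ghw_eq Q hN hN' hθ hinj (A.map j) fun H hH => by
      have h1 := le_natCard_mul_traceSupp Q hmax hn' H
      rw [natCard_submodule, hH, h0, ← hS] at h1
      exact_mod_cast le_of_mul_le_mul_left h1 (by positivity)
    rw [h0] at hg
    have hS' : (p : ℝ) ^ r * traceSupp Q (A.map j) =
        Nat.card K * ((p ^ r - 1) * (Nat.card E₁ * Nat.card E₂ - Nat.card E₂ * n)) := by
      exact_mod_cast hS
    rw [← hg, rK, rE₁, rE₂, Nat.cast_mul] at hS'
    rw [div_mul_eq_mul_div, eq_div_iff (hpN r).ne', pow_add]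
    linear_combination hS' - (p ^ r - 1) * q ^ m₂ * ht₀
  · have hd : m * (m₂ + 1) + m = m * (m₂ + 2) := by ring
    have hd' : m * m₂ + m = m * (m₂ + 1) := by ring
    -- Middle range: the complement has dimension at least `m`, so the last coordinate can run over
    -- all of `K`, and `B` takes the remaining dimension.
    obtain ⟨B, hB⟩ := exists_submodule_finrank_eq (F := ZMod p) (V := E₂)
      (n := m * (m₂ + 1) - r) (by omega)
    obtain ⟨H₀, h1, h2, h3⟩ := exists_orthogonal_eq t₀ B (⊤ : Submodule (ZMod p) K)
    have hS := traceSupp_add_eq Q t₀ h2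
    rw [finrank_top, fK, fV, hB] at h1
    have h0 : Module.finrank (ZMod p) H₀ = r := by omega
    have hB' : Nat.card B * Nat.card K = p ^ (m * (m₂ + 2) - r) := by
      rw [natCard_submodule, hB, Nat.card_eq_fintype_card, hK, ← pow_add]
      congr 1
      omega
    rw [h3, Nat.card_congr Submodule.topEquiv.toEquiv, ← hn] at hS
    have hg := mul_ghw_eq Q hN hN' hθ hinj H₀ fun H hH => by
      have h4 := le_traceSupp_add Q hmax H
      have h5 := (natCard_last_ne_zero ((pairing p K E₂).orthogonal H)).2
      rw [natCard_submodule, fP, hH, h0, ← hB'] at h5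
      have h6 : Nat.card {v : K × E₂ × K // v ∈ (pairing p K E₂).orthogonal H ∧ v.2.2 ≠ 0} ≤
          Nat.card B * (Nat.card K - 1) := by
        refine Nat.le_of_mul_le_mul_left (c := Nat.card K) ?_ Nat.card_pos
        obtain ⟨k, hk⟩ : ∃ k, Nat.card K = k + 1 := ⟨Nat.card K - 1, by
          rw [Nat.card_eq_fintype_card]; omega⟩
        rw [hk] at h5 ⊢
        rw [Nat.add_sub_cancel]
        linarith
      have h7 := Nat.mul_le_mul_right n h6
      linarith
    rw [h0] at hg
    have hS' : (traceSupp Q H₀ : ℝ) + Nat.card B * (Nat.card K - 1) * n +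
        Nat.card E₁ * Nat.card E₂ = Nat.card K * (Nat.card E₁ * Nat.card E₂) := by
      rw [← Nat.cast_one, ← Nat.cast_sub Nat.card_pos]
      exact_mod_cast hS
    have hB2 : (Nat.card B : ℝ) * p ^ r = q ^ (m₂ + 1) := by
      rw [rK', natCard_submodule, hB, Nat.cast_pow, ← pow_add, ← pow_mul]
      congr 1
      omega
    rw [← hg, rK, rE₁, rE₂, Nat.cast_mul] at hS'
    rw [div_mul_eq_mul_div, eq_div_iff (hpN r).ne', pow_add]
    linear_combination p ^ r * hS' - (q - 1) * n * hB2 - (q - 1) * q ^ m₂ * ht₀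
  · have hd : m * (m₂ + 1) + m = m * (m₂ + 2) := by ring
    -- Last range: the complement has dimension less than `m`, so it can be chosen with only `0`
    -- having last coordinate `0`.
    obtain ⟨G, hG⟩ := exists_submodule_finrank_eq (F := ZMod p) (V := K)
      (n := m * (m₂ + 2) - r) (by omega)
    obtain ⟨H₀, h1, h2, h3⟩ := exists_orthogonal_eq t₀ (⊥ : Submodule (ZMod p) E₂) G
    have hS := traceSupp_add_eq Q t₀ h2
    rw [finrank_bot, fV, hG] at h1
    have h0 : Module.finrank (ZMod p) H₀ = r := by omega
    have hG' : Nat.card G = p ^ (m * (m₂ + 2) - r) := by rw [natCard_submodule, hG]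
    have hbot : Nat.card (⊥ : Submodule (ZMod p) E₂) = 1 := by simp
    rw [h3, hbot, one_mul, ← hn] at hS
    have hg := mul_ghw_eq Q hN hN' hθ hinj H₀ fun H hH => by
      have h4 := le_traceSupp_add Q hmax H
      have h5 := (natCard_last_ne_zero ((pairing p K E₂).orthogonal H)).1
      rw [natCard_submodule, fP, hH, h0, ← hG'] at h5
      have h7 := Nat.mul_le_mul_right n (Nat.le_sub_of_add_le h5)
      linarith
    rw [h0] at hg
    have hS' : (traceSupp Q H₀ : ℝ) + (Nat.card G - 1) * n +
        Nat.card E₁ * Nat.card E₂ = Nat.card K * (Nat.card E₁ * Nat.card E₂) := by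
      rw [← Nat.cast_one, ← Nat.cast_sub Nat.card_pos]
      exact_mod_cast hS
    have hG2 : (Nat.card G : ℝ) * p ^ r = q ^ (m₂ + 2) := by
      rw [rK', hG', Nat.cast_pow, ← pow_add, ← pow_mul]
      congr 1
      omega
    have hr2 : (p : ℝ) ^ r = p ^ (r - m * (m₂ + 1)) * q ^ (m₂ + 1) := by
      rw [rK', ← pow_mul, ← pow_add]
      congr 1
      omega
    rw [← hg, rK, rE₁, rE₂, Nat.cast_mul] at hS'
    rw [div_mul_eq_mul_div, eq_div_iff (hpN r).ne', pow_add]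
    linear_combination p ^ r * hS' - n * hG2 + n * hr2 -
      (q - p ^ (r - m * (m₂ + 1))) * q ^ m₂ * ht₀

end Hierarchy

/-! ### The largest fibre of `Q`. -/

section MaxCount

variable {K E : Type*} [Field K] [Fintype K] [DecidableEq K] [AddCommGroup E] [Module K E]
  [FiniteDimensional K E]

/-- With `p = 2j + 1` the exponent is `j * m * k`, and `χ(-1) = (-1)^(j m)`. Thus the normalized
sign is the one in the fibre formula. -/
theorem normSign_of_rank_even {p m k : ℕ} [Fact p.Prime] (hp : p ≠ 2)
    (hK : Fintype.card K = p ^ m) (h2 : ringChar K ≠ 2) (Q : QuadraticForm K E)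
    (hk : rank Q = 2 * k) : normSign p m Q = quadraticChar K (-1) ^ k * sign Q := by
  obtain ⟨j, hj⟩ := (Fact.out : p.Prime).odd_of_ne_two hp
  have hχ : quadraticChar K (-1) = (-1) ^ (j * m) := by
    rw [quadraticChar_neg_one h2, hK, Nat.cast_pow, map_pow, ZMod.χ₄_eq_neg_one_pow (by omega),
      ← pow_mul]
    congr 2
    omega
  have he : (p - 1) * m * (2 * k) / 4 = j * m * k := by
    rw [hj, Nat.add_sub_cancel, show 2 * j * m * (2 * k) = 4 * (j * m * k) by ring,
      Nat.mul_div_cancel_left _ (by norm_num)]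
  rw [normSign, if_pos (by rw [hk]; exact even_two_mul k), hk, he, hχ, ← pow_mul, mul_comm]

/-- The element with the most representations by a form of even rank. -/
theorem exists_max_of_rank_even {p m k : ℕ} [Fact p.Prime] (hp : p ≠ 2)
    (hK : Fintype.card K = p ^ m) (h2 : ringChar K ≠ 2) (Q : QuadraticForm K E)
    (hk : rank Q = 2 * k) :
    (normSign p m Q = 1 ∨ normSign p m Q = -1) ∧
    (normSign p m Q = 1 → ∃ t₀, (∀ t, Nat.card {x // Q x = t} ≤ Nat.card {x // Q x = t₀}) ∧
      (Nat.card {x // Q x = t₀} : ℝ) * Fintype.card K =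
        Fintype.card K ^ Module.finrank K E *
          (1 + ((Fintype.card K : ℝ) ^ k)⁻¹ * (Fintype.card K - 1))) ∧
    (normSign p m Q = -1 → ∃ t₀, (∀ t, Nat.card {x // Q x = t} ≤ Nat.card {x // Q x = t₀}) ∧
      (Nat.card {x // Q x = t₀} : ℝ) * Fintype.card K =
        Fintype.card K ^ Module.finrank K E * (1 + ((Fintype.card K : ℝ) ^ k)⁻¹)) := by
  have hs := normSign_of_rank_even hp hK h2 Q hk
  have hc := natCard_of_rank_even h2 Q hk
  rw [← hs] at hc
  have hq : (1 : ℤ) < Fintype.card K := by exact_mod_cast Fintype.one_lt_card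
  have hq' : (Fintype.card K : ℝ) ≠ 0 := by exact_mod_cast Fintype.card_ne_zero
  -- All nonzero `t` have equally large fibres; the fibre over `0` is larger for sign `1` and
  -- smaller for sign `-1`, whence the witnesses `0` and `1`.
  refine ⟨?_, fun h => ⟨0, fun t => ?_, ?_⟩, fun h => ⟨1, fun t => ?_, ?_⟩⟩
  · rw [hs]
    have h1 : quadraticChar K (-1) ^ k = 1 ∨ quadraticChar K (-1) ^ k = -1 := by
      rcases quadraticChar_dichotomy (F := K) (a := -1) (neg_ne_zero.2 one_ne_zero) with h | h
      · simp [h]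
      · rw [h]; exact neg_one_pow_eq_or ℤ k
    rcases h1 with h1 | h1 <;> rcases sign_sq h2 Q with h3 | h3 <;> rw [h1, h3] <;> simp
  · zify
    refine le_of_mul_le_mul_right ?_ (by positivity : (0 : ℤ) < Fintype.card K ^ (k + 1))
    rw [hc, hc, h]
    gcongr
    split_ifs <;> first | omega | simp_all
  · have h1 : (Nat.card {x // Q x = 0} : ℝ) * Fintype.card K ^ (k + 1) =
      Fintype.card K ^ Module.finrank K E * (Fintype.card K ^ k + (Fintype.card K - 1)) := by
      have := hc 0
      rw [h, if_pos rfl, one_mul] at this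
      exact_mod_cast this
    field_simp
    linear_combination h1
  · zify
    refine le_of_mul_le_mul_right ?_ (by positivity : (0 : ℤ) < Fintype.card K ^ (k + 1))
    rw [hc, hc, h]
    refine mul_le_mul_of_nonneg_left (add_le_add_right ?_ _) (by positivity)
    split_ifs <;> first | omega | simp_all
  · have h1 : (Nat.card {x // Q x = 1} : ℝ) * Fintype.card K ^ (k + 1) =
      Fintype.card K ^ Module.finrank K E * (Fintype.card K ^ k + 1) := by
      have := hc 1
      rw [h, if_neg one_ne_zero, neg_one_mul, neg_neg] at this
      exact_mod_cast this
    field_simp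
    linear_combination h1

/-- The element with the most representations by a form of odd rank. -/
theorem exists_max_of_rank_odd {k : ℕ} (h2 : ringChar K ≠ 2) (Q : QuadraticForm K E)
    (hk : rank Q = 2 * k + 1) :
    ∃ t₀, (∀ t, Nat.card {x // Q x = t} ≤ Nat.card {x // Q x = t₀}) ∧
      (Nat.card {x // Q x = t₀} : ℝ) * Fintype.card K =
        Fintype.card K ^ Module.finrank K E * (1 + ((Fintype.card K : ℝ) ^ k)⁻¹) := by
  obtain ⟨d, hd, hc⟩ := natCard_of_rank_odd h2 Q hk
  have hq' : (Fintype.card K : ℝ) ≠ 0 := by exact_mod_cast Fintype.card_ne_zero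
  have hq0 : (0 : ℤ) < Fintype.card K := by exact_mod_cast Fintype.card_pos
  have h1 := hc d
  rw [← sq, quadraticChar_sq_one' hd] at h1
  -- The character term `χ (d * t)` reaches its maximum `1` at `t = d`.
  refine ⟨d, fun t => ?_, ?_⟩
  · zify
    refine le_of_mul_le_mul_right ?_ (by positivity : (0 : ℤ) < Fintype.card K ^ (k + 1))
    rw [hc, h1]
    gcongr
    by_cases ht : d * t = 0
    · simp [ht]
    · rcases quadraticChar_dichotomy ht with h | h <;> rw [h]
      norm_num
  · have h3 : (Nat.card {x // Q x = d} : ℝ) * Fintype.card K ^ (k + 1) =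
      Fintype.card K ^ Module.finrank K E * (Fintype.card K ^ k + 1) := by exact_mod_cast h1
    field_simp
    linear_combination h3

end MaxCount

end QuadCode

/-! ### Assembly by parity of the rank and sign. -/

theorem mainTheorem6
    (p m m₁ m₂ q N : ℕ) [Fact p.Prime] (hp : p ≠ 2) (hm : 0 < m) (hm₁ : 0 < m₁) (hm₂ : 0 < m₂)
    (hq : q = p ^ m)
    {K E₁ E₂ : Type*} [Field K] [Fintype K] [DecidableEq K] [Algebra (ZMod p) K]
    [Field E₁] [Algebra K E₁] [Field E₂] [Algebra K E₂]
    (hK : Fintype.card K = q)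
    (hE₁ : Module.finrank K E₁ = m₁) (hE₂ : Module.finrank K E₂ = m₂)
    (hN : N ∣ p - 1) (hN' : Nat.Coprime N ((q - 1) / (p - 1)))
    (θ : K) (hθ : IsPrimitiveRoot θ ((q - 1) / N))
    (Q : QuadraticForm K E₁) (hQ : Q ≠ 0)
    (M R : ℕ) (hM : M = m₁ + m₂) (hR : R = QuadCode.rank Q)
    (C : Submodule (ZMod p) (Fin ((q - 1) / N) × (E₁ × E₂) → ZMod p))
    (hC : C = QuadCode.descend p ((q - 1) / N) θ (QuadCode.codeQ' E₂ Q)) :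
    Module.finrank (ZMod p) C = m * (m₂ + 2) ∧
    ∀ r : ℕ, 1 ≤ r → r ≤ m * (m₂ + 2) →
      (Even R → QuadCode.normSign p m Q = 1 →
        (r ≤ m → (QuadCode.ghw C r : ℝ) =
          (q : ℝ) ^ M * (q - 1) / (p ^ r * N) *
            ((p ^ r - 1) * (1 - (q : ℝ) ^ (-(R : ℝ) / 2)))) ∧
        (m < r → r ≤ m * (m₂ + 1) → (QuadCode.ghw C r : ℝ) =
          (q : ℝ) ^ M * (q - 1) / (p ^ r * N) *
            (p ^ r - 1 - (q : ℝ) ^ (-(R : ℝ) / 2) * (q - 1))) ∧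
        (m * (m₂ + 1) < r → (QuadCode.ghw C r : ℝ) =
          (q : ℝ) ^ M / (p ^ r * N) *
            (p ^ r * (q - 1) -
              (q - p ^ (r - m * (m₂ + 1))) * (1 + (q : ℝ) ^ (-(R : ℝ) / 2) * (q - 1))))) ∧
      (Even R → QuadCode.normSign p m Q = -1 →
        (r ≤ m → (QuadCode.ghw C r : ℝ) =
          (q : ℝ) ^ M / (p ^ r * N) *
            ((p ^ r - 1) * (q - 1 - (q : ℝ) ^ (-(R : ℝ) / 2)))) ∧
        (m < r → r ≤ m * (m₂ + 1) → (QuadCode.ghw C r : ℝ) =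
          (q : ℝ) ^ M * (q - 1) / (p ^ r * N) *
            (p ^ r - 1 - (q : ℝ) ^ (-(R : ℝ) / 2))) ∧
        (m * (m₂ + 1) < r → (QuadCode.ghw C r : ℝ) =
          (q : ℝ) ^ M / (p ^ r * N) *
            (p ^ r * (q - 1) -
              (q - p ^ (r - m * (m₂ + 1))) * (1 + (q : ℝ) ^ (-(R : ℝ) / 2))))) ∧
      (Odd R →
        (r ≤ m → (QuadCode.ghw C r : ℝ) =
          (q : ℝ) ^ M / (p ^ r * N) *
            ((p ^ r - 1) * (q - 1 - (q : ℝ) ^ ((1 - (R : ℝ)) / 2)))) ∧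
        (m < r → r ≤ m * (m₂ + 1) → (QuadCode.ghw C r : ℝ) =
          (q : ℝ) ^ M * (q - 1) / (p ^ r * N) *
            (p ^ r - 1 - (q : ℝ) ^ ((1 - (R : ℝ)) / 2))) ∧
        (m * (m₂ + 1) < r → (QuadCode.ghw C r : ℝ) =
          (q : ℝ) ^ M / (p ^ r * N) *
            (p ^ r * (q - 1) -
              (q - p ^ (r - m * (m₂ + 1))) * (1 + (q : ℝ) ^ ((1 - (R : ℝ)) / 2))))) := by
  subst hK hC hR hM
  have hp' : p.Prime := Fact.out
  have hchar : ringChar K ≠ 2 := by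
    have : CharP K p := charP_of_injective_algebraMap (algebraMap (ZMod p) K).injective p
    rwa [ringChar.eq K p]
  have hfin : FiniteDimensional K E₁ := FiniteDimensional.of_finrank_pos (by omega)
  have hcard : Nat.card E₁ = Fintype.card K ^ m₁ := by
    rw [Module.natCard_eq_pow_finrank (K := K), hE₁, Nat.card_eq_fintype_card]
  -- Since `p` is odd, `q ≥ 3`, so `ω = q^(-k) ≤ 1 < q - 1` even for `k = 0`, which occurs in odd
  -- rank.
  have hq3 : 3 ≤ Fintype.card K := by
    have h3 : 3 ≤ p := by have := hp'.two_le; omega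
    rw [hq]
    exact h3.trans (Nat.le_self_pow hm.ne' p)
  have hq3' : (3 : ℝ) ≤ Fintype.card K := by exact_mod_cast hq3
  have hpow : ∀ k : ℕ, 0 < ((Fintype.card K : ℝ) ^ k)⁻¹ := fun k => by positivity
  have hpow_le : ∀ k : ℕ, ((Fintype.card K : ℝ) ^ k)⁻¹ ≤ 1 := fun k =>
    inv_le_one_of_one_le₀ (one_le_pow₀ (by linarith))
  have main := fun (ω : ℝ) => QuadCode.weight_hierarchy (E₂ := E₂) (ω := ω) hq hcard hE₂ hm₂ hN hN'
    hθ Q rfl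
  rcases Nat.even_or_odd' (QuadCode.rank Q) with ⟨k, hk | hk⟩
  -- For sign `1` the inequality `ω = q^(-k) * (q - 1) < q - 1` requires `k ≠ 0`; this is where `Q ≠
  -- 0` enters.
  · have hk0 : k ≠ 0 := by
      rintro rfl
      exact (QuadCode.rank_pos hchar hQ).ne' hk
    have hlt : ((Fintype.card K : ℝ) ^ k)⁻¹ < 1 :=
      inv_lt_one_of_one_lt₀ (one_lt_pow₀ (by linarith) hk0)
    have hodd : ¬ Odd (QuadCode.rank Q) := by
      rw [Nat.not_odd_iff_even, hk]
      exact even_two_mul k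
    have hrpow : (Fintype.card K : ℝ) ^ (-(QuadCode.rank Q : ℝ) / 2) =
        ((Fintype.card K : ℝ) ^ k)⁻¹ := by
      rw [hk, ← Real.rpow_natCast, ← Real.rpow_neg (by positivity)]
      congr 1
      push_cast
      ring
    rw [hrpow]
    obtain ⟨hs, h1, h2⟩ := QuadCode.exists_max_of_rank_even hp hq hchar Q hk
    rw [hE₁] at h1 h2
    rcases hs with hs | hs
    · obtain ⟨t₀, hmax, ht₀⟩ := h1 hs
      obtain ⟨hdim, hw⟩ := main _ (mul_nonneg (hpow k).le (by linarith))
        (mul_lt_of_lt_one_left (by linarith) hlt) t₀ hmax ht₀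
      refine ⟨hdim, fun r _ hr => ⟨fun _ _ => ?_, fun _ h => ?_, fun h => absurd h hodd⟩⟩
      · obtain ⟨w1, w2, w3⟩ := hw r hr
        refine ⟨fun h => ?_, w2, w3⟩
        rw [w1 h]
        ring
      · rw [hs] at h; norm_num at h
    · obtain ⟨t₀, hmax, ht₀⟩ := h2 hs
      obtain ⟨hdim, hw⟩ := main _ (hpow k).le (by linarith) t₀ hmax ht₀
      refine ⟨hdim, fun r _ hr => ⟨fun _ h => ?_, fun _ _ => hw r hr, fun h => absurd h hodd⟩⟩
      rw [hs] at h; norm_num at h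
  · have heven : ¬ Even (QuadCode.rank Q) := by
      rw [Nat.not_even_iff_odd, hk]
      exact odd_two_mul_add_one k
    have hrpow : (Fintype.card K : ℝ) ^ ((1 - (QuadCode.rank Q : ℝ)) / 2) =
        ((Fintype.card K : ℝ) ^ k)⁻¹ := by
      rw [hk, ← Real.rpow_natCast, ← Real.rpow_neg (by positivity)]
      congr 1
      push_cast
      ring
    rw [hrpow]
    obtain ⟨t₀, hmax, ht₀⟩ := QuadCode.exists_max_of_rank_odd hchar Q hk
    rw [hE₁] at ht₀
    obtain ⟨hdim, hw⟩ := main _ (hpow k).le (by linarith [hpow_le k]) t₀ hmax ht₀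
    exact ⟨hdim, fun r _ hr => ⟨fun h => absurd h heven, fun h => absurd h heven,
      fun _ => hw r hr⟩⟩
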